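/- Consider the system $\dot x = Ax + Ed$, $z = Hx$ with state $x\in\mathbb R^n$, disturbance $d\in\mathbb R^q$ and output to be estimated $z\in\mathbb R^p$, together with local measurements $y_i = C_i x + D_i d\in\mathbb R^{r_i}$, $i=1,\dots,N$ ($N\ge 1$). For a pair $(C,A)$ of real matrices let the undetectable subspace be $\mathcal S(C,A)=\bigcap_{k=0}^{n-1}\ker(CA^k)\cap\ker p_+(A)$, where $p_+$ is the monic factor of the characteristic polynomial of $A$ collecting its roots in the closed right half-plane; $(C,A)$ is detectable if $\mathcal S(C,A)=\{0\}$. Assume that $(C,A)$ is detectable, where $C$ is obtained by stacking $C_1,\dots,C_N$. Let $\mathcal G$ be a strongly connected weighted directed graph on $\{1,\dots,N\}$ with nonnegative adjacency matrix $[a_{ij}]$ ($a_{ji}\neq 0$ iff $(i,j)$ is an edge) and Laplacian $L=\mathrm{diag}\big(\sum_j a_{ij}\big)-[a_{ij}]$. Consider distributed filters $$\dot w_i = A w_i + G_i(y_i - C_i w_i) + F_i\sum_{j=1}^N a_{ij}(w_j-w_i),\qquad \zeta_i = Hw_i ,\qquad i=1,\dots,N.$$ Put $T_d(t) = (I_N\otimes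 H)\,e^{(\bar A-\bar F(L\otimes I_n))t}\,\bar E$ with $\bar A=\mathrm{blockdiag}(A-G_iC_i)$, $\bar F=\mathrm{blockdiag}(F_i)$, $\bar E=\mathrm{col}(E-G_iD_i)$, and $J=\int_0^\infty \mathrm{tr}\,[T_d(t)^\top T_d(t)]\,dt$. The filter is called $\mathcal H_2$ $\gamma$-suboptimal if, with $d=0$, $x(t)-w_i(t)\to 0$ as $t\to\infty$ for all $i$ and all initial conditions, and $J<\gamma$. Then each of the following steps can be carried out. 1. There is a unique $\theta=(\theta_1,\dots,\theta_N)$ with all $\theta_i>0$, $\theta L=0$ and $\sum_i\theta_i=N$. Take this $\theta$, and put $\Theta=\mathrm{diag}(\theta_i)$ and $\mathcal L=\Theta L+L^\top\Theta$. 2. For each $i$ there is an orthogonal matrix $T_i$ with $$T_i^\top A T_i=\begin{pmatrix}A_{i11}&0\\A_{i21}&A_{i22}\end{pmatrix},\qquad C_iT_i=\begin{pmatrix}C_{i1}&0\end{pmatrix},$$ $A_{i11}\in\mathbb R^{v_i\times v_i}$, $v_i=n-\dim\mathcal S(C_i,A)$, and $(C_{i1},A_{i11})$ detectable. Take any such $T_i$,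 and partition accordingly $T_i^\top E=\begin{pmatrix}E_{i1}\\E_{i2}\end{pmatrix}$ and $HT_i=\begin{pmatrix}H_{i1}&H_{i2}\end{pmatrix}$. 3. Let $T=\mathrm{blockdiag}(T_i)$ and $M=\mathrm{blockdiag}(M_i)$ with $M_i=\begin{pmatrix}I_{v_i}&0\\0&0\end{pmatrix}$. Then $T^\top(\mathcal L\otimes I_n)T+M>\epsilon I_{nN}$ for all sufficiently small $\epsilon>0$. Take any $\epsilon>0$ satisfying this inequality. 4. For each $i$ there is $Q_{i1}>0$ with $A_{i11}Q_{i1}+Q_{i1}A_{i11}^\top-Q_{i1}C_{i1}^\top C_{i1}Q_{i1}<0$. Take any such $Q_{i1}$ and put $G_{i1}=Q_{i1}C_{i1}^\top$. 5. For all sufficiently large $\kappa>0$, the inequality $$A_{i22}+A_{i22}^\top+H_{i2}^\top H_{i2}-\kappa\epsilon I_{n-v_i}+\tfrac1{\kappa\epsilon}(A_{i21}+H_{i2}^\top H_{i1})(A_{i21}+H_{i2}^\top H_{i1})^\top<0$$ holds for all $i=1,\dots,N$. Take any $\kappa>0$ for which it holds for all $i$. 6. For each $i$ there is a unique $P_{i1}>0$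 with $(A_{i11}-G_{i1}C_{i1})^\top P_{i1}+P_{i1}(A_{i11}-G_{i1}C_{i1})+H_{i1}^\top H_{i1}+\kappa I_{v_i}=0$. Take this $P_{i1}$. 7. Put $F_i=\kappa\theta_i\,T_i\begin{pmatrix}P_{i1}^{-1}&0\\0&I_{n-v_i}\end{pmatrix}T_i^\top$ and $G_i=T_i\begin{pmatrix}G_{i1}\\0\end{pmatrix}$. Moreover, for all such choices and for every $\gamma>0$ with $$\sum_{i=1}^N\mathrm{tr}\left[(E_{i1}-G_{i1}D_i)^\top P_{i1}(E_{i1}-G_{i1}D_i)+E_{i2}^\top E_{i2}\right]<\gamma,$$ the distributed filter with gains $F_i,G_i$ is $\mathcal H_2$ $\gamma$-suboptimal; in particular, the global error system is internally stable, that is, $\bar A-\bar F(L\otimes I_n)$ is Hurwitz, and $J<\gamma$. -/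

import Mathlib

open Matrix Polynomial
open scoped Kronecker

/-! ### Weighted directed graphs -/

/-- A weighted directed graph on the nodes `Fin N`, given by its adjacency matrix with nonnegative
entries; `weight j i` is the weight of the edge `(i, j)`, and `(i, j)` is an edge exactly when
this weight is nonzero. -/
structure WeightedDigraph (N : ℕ) where
  weight : Matrix (Fin N) (Fin N) ℝ
  weight_nonneg : ∀ i j, 0 ≤ weight i j

namespace WeightedDigraph

variable {N : ℕ}

/-- `(i, j)` is an edge. -/
def Edge (g : WeightedDigraph N) (i j : Fin N) : Prop :=
  g.weight j i ≠ 0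

/-- Any two distinct nodes are joined by a directed path. -/
def StronglyConnected (g : WeightedDigraph N) : Prop :=
  ∀ i j : Fin N, i ≠ j → Relation.TransGen g.Edge i j

/-- The Laplacian `D - 𝒜`, where `D` is the diagonal matrix of the row sums of `𝒜`. -/
def laplacian (g : WeightedDigraph N) : Matrix (Fin N) (Fin N) ℝ :=
  Matrix.diagonal (fun i => ∑ j, g.weight i j) - g.weight

/-- `θ` is a positive row vector with `θ L = 0` and `θ 𝟏 = N`. -/
def IsLeftNullVector (g : WeightedDigraph N) (θ : Fin N → ℝ) : Prop :=
  (∀ i, 0 < θ i) ∧ θ ᵥ* g.laplacian = 0 ∧ ∑ i, θ i = (N : ℝ)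

/-- The matrix `ΘL + LᵀΘ` with `Θ = diag θ`. -/
def symLaplacian (g : WeightedDigraph N) (θ : Fin N → ℝ) : Matrix (Fin N) (Fin N) ℝ :=
  Matrix.diagonal θ * g.laplacian + g.laplacianᵀ * Matrix.diagonal θ

end WeightedDigraph

/-! ### Stability and detectability -/

/-- A real square matrix is Hurwitz if all its complex eigenvalues have negative real part. -/
def IsHurwitz {ι : Type*} [Fintype ι] [DecidableEq ι] (A : Matrix ι ι ℝ) : Prop :=
  ∀ z ∈ spectrum ℂ (A.map (fun x : ℝ => (x : ℂ))), z.re < 0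

open Classical in
/-- The monic factor `p₊` of the characteristic polynomial `p = p₋ p₊` of `A` that collects the
roots in the closed right half-plane: the product, with multiplicities, of those monic irreducible
real factors of `p` whose complex roots have nonnegative real part. (The complex roots of one real
irreducible factor all have the same real part.) -/
noncomputable def unstableFactor {ι : Type*} [Fintype ι] [DecidableEq ι] (A : Matrix ι ι ℝ) :
    ℝ[X] :=
  ((UniqueFactorizationMonoid.normalizedFactors A.charpoly).filter
    (fun f => ∀ z : ℂ, Polynomial.aeval z f = 0 → 0 ≤ z.re)).prod

/-- The undetectable subspace of `(C, A)`: the intersection of the kernels of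
`C, CA, …, CA^(n-1)` and of `p₊(A)`. -/
noncomputable def undetectableSubspace {ι μ : Type*} [Fintype ι] [DecidableEq ι]
    (C : Matrix μ ι ℝ) (A : Matrix ι ι ℝ) : Submodule ℝ (ι → ℝ) :=
  (⨅ k : Fin (Fintype.card ι), LinearMap.ker (Matrix.mulVecLin (C * A ^ (k : ℕ)))) ⊓
    LinearMap.ker (Matrix.mulVecLin (Polynomial.aeval A (unstableFactor A)))

/-- `(C, A)` is detectable if its undetectable subspace is zero. -/
def IsDetectable {ι μ : Type*} [Fintype ι] [DecidableEq ι]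
    (C : Matrix μ ι ℝ) (A : Matrix ι ι ℝ) : Prop :=
  undetectableSubspace C A = ⊥

/-- A detectability decomposition of `(C, A)`: an orthogonal matrix `T`, its columns split into
the first `v` and the last `n - v`, that brings `A` and `C` into the form
`Tᵀ A T = [A₁₁ 0; A₂₁ A₂₂]`, `C T = [C₁ 0]` with `(C₁, A₁₁)` detectable, where
`v = n - dim S` is the dimension of the orthogonal complement of the undetectable subspace `S`. -/
structure DetectabilityDecomposition {n s : ℕ} (C : Matrix (Fin s) (Fin n) ℝ)
    (A : Matrix (Fin n) (Fin n) ℝ) where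
  v : ℕ
  v_add_finrank : v + Module.finrank ℝ (undetectableSubspace C A) = n
  T : Matrix (Fin n) (Fin v ⊕ Fin (n - v)) ℝ
  transpose_mul_self : Tᵀ * T = 1
  mul_transpose_self : T * Tᵀ = 1
  toBlocks₁₂_eq_zero : (Tᵀ * A * T).toBlocks₁₂ = 0
  toCols₂_eq_zero : (C * T).toCols₂ = 0
  detectable : IsDetectable (C * T).toCols₁ (Tᵀ * A * T).toBlocks₁₁

namespace DetectabilityDecomposition

variable {n s q p : ℕ} {C : Matrix (Fin s) (Fin n) ℝ} {A : Matrix (Fin n) (Fin n) ℝ}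

def A₁₁ (d : DetectabilityDecomposition C A) : Matrix (Fin d.v) (Fin d.v) ℝ :=
  (d.Tᵀ * A * d.T).toBlocks₁₁

def A₂₁ (d : DetectabilityDecomposition C A) : Matrix (Fin (n - d.v)) (Fin d.v) ℝ :=
  (d.Tᵀ * A * d.T).toBlocks₂₁

def A₂₂ (d : DetectabilityDecomposition C A) : Matrix (Fin (n - d.v)) (Fin (n - d.v)) ℝ :=
  (d.Tᵀ * A * d.T).toBlocks₂₂

def C₁ (d : DetectabilityDecomposition C A) : Matrix (Fin s) (Fin d.v) ℝ :=
  (C * d.T).toCols₁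

def E₁ (d : DetectabilityDecomposition C A) (E : Matrix (Fin n) (Fin q) ℝ) :
    Matrix (Fin d.v) (Fin q) ℝ :=
  (d.Tᵀ * E).toRows₁

def E₂ (d : DetectabilityDecomposition C A) (E : Matrix (Fin n) (Fin q) ℝ) :
    Matrix (Fin (n - d.v)) (Fin q) ℝ :=
  (d.Tᵀ * E).toRows₂

def H₁ (d : DetectabilityDecomposition C A) (H : Matrix (Fin p) (Fin n) ℝ) :
    Matrix (Fin p) (Fin d.v) ℝ :=
  (H * d.T).toCols₁

def H₂ (d : DetectabilityDecomposition C A) (H : Matrix (Fin p) (Fin n) ℝ) :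
    Matrix (Fin p) (Fin (n - d.v)) ℝ :=
  (H * d.T).toCols₂

/-- The Riccati inequality `A₁₁ Q + Q A₁₁ᵀ - Q C₁ᵀ C₁ Q < 0`. -/
def RiccatiIneq (d : DetectabilityDecomposition C A) (Q : Matrix (Fin d.v) (Fin d.v) ℝ) : Prop :=
  (-(d.A₁₁ * Q + Q * d.A₁₁ᵀ - Q * d.C₁ᵀ * d.C₁ * Q)).PosDef

/-- The gain `G₁ = Q C₁ᵀ`. -/
def G₁ (d : DetectabilityDecomposition C A) (Q : Matrix (Fin d.v) (Fin d.v) ℝ) :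
    Matrix (Fin d.v) (Fin s) ℝ :=
  Q * d.C₁ᵀ

/-- The inequality
`A₂₂ + A₂₂ᵀ + H₂ᵀ H₂ - κ ε I + (1 / (κ ε)) (A₂₁ + H₂ᵀ H₁) (A₂₁ + H₂ᵀ H₁)ᵀ < 0`. -/
def KappaIneq (d : DetectabilityDecomposition C A) (H : Matrix (Fin p) (Fin n) ℝ) (ε κ : ℝ) :
    Prop :=
  (-(d.A₂₂ + d.A₂₂ᵀ + (d.H₂ H)ᵀ * d.H₂ H
      - (κ * ε) • (1 : Matrix (Fin (n - d.v)) (Fin (n - d.v)) ℝ)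
      + (1 / (κ * ε)) •
        ((d.A₂₁ + (d.H₂ H)ᵀ * d.H₁ H) * (d.A₂₁ + (d.H₂ H)ᵀ * d.H₁ H)ᵀ))).PosDef

/-- The Lyapunov equation
`(A₁₁ - G₁ C₁)ᵀ P + P (A₁₁ - G₁ C₁) + H₁ᵀ H₁ + κ I = 0`. -/
def LyapunovEq (d : DetectabilityDecomposition C A) (H : Matrix (Fin p) (Fin n) ℝ)
    (Q : Matrix (Fin d.v) (Fin d.v) ℝ) (κ : ℝ) (P : Matrix (Fin d.v) (Fin d.v) ℝ) : Prop :=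
  (d.A₁₁ - d.G₁ Q * d.C₁)ᵀ * P + P * (d.A₁₁ - d.G₁ Q * d.C₁)
    + (d.H₁ H)ᵀ * d.H₁ H + κ • (1 : Matrix (Fin d.v) (Fin d.v) ℝ) = 0

/-- The gain `F = κ θ T [P⁻¹ 0; 0 I] Tᵀ`; here `c` stands for `κ θ`. -/
noncomputable def gainF (d : DetectabilityDecomposition C A) (c : ℝ)
    (P : Matrix (Fin d.v) (Fin d.v) ℝ) : Matrix (Fin n) (Fin n) ℝ :=
  c • (d.T *
    (Matrix.fromBlocks P⁻¹ 0 0 1 :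
      Matrix (Fin d.v ⊕ Fin (n - d.v)) (Fin d.v ⊕ Fin (n - d.v)) ℝ) * d.Tᵀ)

/-- The gain `G = T [G₁; 0]`. -/
def gainG (d : DetectabilityDecomposition C A) (Q : Matrix (Fin d.v) (Fin d.v) ℝ) :
    Matrix (Fin n) (Fin s) ℝ :=
  d.T * Matrix.fromRows (d.G₁ Q) 0

/-- `tr [(E₁ - G₁ D)ᵀ P (E₁ - G₁ D) + E₂ᵀ E₂]`. -/
def traceTerm (d : DetectabilityDecomposition C A) (E : Matrix (Fin n) (Fin q) ℝ)
    (D : Matrix (Fin s) (Fin q) ℝ) (Q P : Matrix (Fin d.v) (Fin d.v) ℝ) : ℝ :=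
  Matrix.trace ((d.E₁ E - d.G₁ Q * D)ᵀ * P * (d.E₁ E - d.G₁ Q * D) + (d.E₂ E)ᵀ * d.E₂ E)

end DetectabilityDecomposition

/-! ### The plant, the distributed filter and its error system -/

/-- The system `x' = A x + E d`, `z = H x` with the `N` local measurements
`yᵢ = Cᵢ x + Dᵢ d`. -/
structure Plant (N n q p : ℕ) (r : Fin N → ℕ) where
  A : Matrix (Fin n) (Fin n) ℝ
  E : Matrix (Fin n) (Fin q) ℝ
  H : Matrix (Fin p) (Fin n) ℝ
  C : ∀ i, Matrix (Fin (r i)) (Fin n) ℝ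
  D : ∀ i, Matrix (Fin (r i)) (Fin q) ℝ

namespace Plant

variable {N n q p : ℕ} {r : Fin N → ℕ}

/-- The full output matrix `C`, obtained by stacking `C₁, …, C_N`. -/
def stackedC (S : Plant N n q p r) : Matrix (Σ i, Fin (r i)) (Fin n) ℝ :=
  Matrix.of fun a k => S.C a.1 a.2 k

/-- `T = blockdiag(Tᵢ)`. -/
def blockT (S : Plant N n q p r) (dec : ∀ i, DetectabilityDecomposition (S.C i) S.A) :
    Matrix (Fin N × Fin n) (Σ i, Fin (dec i).v ⊕ Fin (n - (dec i).v)) ℝ :=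
  (Matrix.blockDiagonal' fun i => (dec i).T).submatrix (fun a => ⟨a.1, a.2⟩) id

/-- `M = blockdiag(Mᵢ)`, where `Mᵢ = [mᵢ I 0; 0 0]` with `mᵢ = 1`. -/
def blockM (S : Plant N n q p r) (dec : ∀ i, DetectabilityDecomposition (S.C i) S.A) :
    Matrix (Σ i, Fin (dec i).v ⊕ Fin (n - (dec i).v))
      (Σ i, Fin (dec i).v ⊕ Fin (n - (dec i).v)) ℝ :=
  Matrix.blockDiagonal' fun i =>
    (Matrix.fromBlocks 1 0 0 0 :
      Matrix (Fin (dec i).v ⊕ Fin (n - (dec i).v)) (Fin (dec i).v ⊕ Fin (n - (dec i).v)) ℝ)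

/-- The inequality `Tᵀ ((ΘL + LᵀΘ) ⊗ Iₙ) T + M > ε I`. -/
def EpsilonIneq (S : Plant N n q p r) (g : WeightedDigraph N) (θ : Fin N → ℝ)
    (dec : ∀ i, DetectabilityDecomposition (S.C i) S.A) (ε : ℝ) : Prop :=
  ((S.blockT dec)ᵀ * (g.symLaplacian θ ⊗ₖ (1 : Matrix (Fin n) (Fin n) ℝ)) * S.blockT dec
    + S.blockM dec - ε • (1 : Matrix (Σ i, Fin (dec i).v ⊕ Fin (n - (dec i).v))
      (Σ i, Fin (dec i).v ⊕ Fin (n - (dec i).v)) ℝ)).PosDef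

/-- The block diagonal matrix of a family of `n × n` matrices, in the index convention of
`L ⊗ Iₙ`. -/
def blockDiag (B : Fin N → Matrix (Fin n) (Fin n) ℝ) :
    Matrix (Fin N × Fin n) (Fin N × Fin n) ℝ :=
  Matrix.of fun a b => if a.1 = b.1 then B a.1 a.2 b.2 else 0

/-- The state matrix `blockdiag(A - Gᵢ Cᵢ) - blockdiag(Fᵢ) (L ⊗ Iₙ)` of the global error
system. -/
def errorMatrix (S : Plant N n q p r) (g : WeightedDigraph N)
    (F : Fin N → Matrix (Fin n) (Fin n) ℝ) (G : ∀ i, Matrix (Fin n) (Fin (r i)) ℝ) :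
    Matrix (Fin N × Fin n) (Fin N × Fin n) ℝ :=
  blockDiag (fun i => S.A - G i * S.C i)
    - blockDiag F * (g.laplacian ⊗ₖ (1 : Matrix (Fin n) (Fin n) ℝ))

/-- The disturbance matrix `col(E - Gᵢ Dᵢ)` of the global error system. -/
def errorInput (S : Plant N n q p r) (G : ∀ i, Matrix (Fin n) (Fin (r i)) ℝ) :
    Matrix (Fin N × Fin n) (Fin q) ℝ :=
  Matrix.of fun a k => (S.E - G a.1 * S.D a.1) a.2 k

/-- The impulse response from the disturbance to the output estimation errors. -/
noncomputable def impulseResponse (S : Plant N n q p r) (g : WeightedDigraph N)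
    (F : Fin N → Matrix (Fin n) (Fin n) ℝ) (G : ∀ i, Matrix (Fin n) (Fin (r i)) ℝ) (t : ℝ) :
    Matrix (Fin N × Fin p) (Fin q) ℝ :=
  ((1 : Matrix (Fin N) (Fin N) ℝ) ⊗ₖ S.H) * NormedSpace.exp (t • S.errorMatrix g F G)
    * S.errorInput G

/-- The H₂ cost `∫₀^∞ tr[T_d(t)ᵀ T_d(t)] dt`, a number in `[0, ∞]`. -/
noncomputable def h2Cost (S : Plant N n q p r) (g : WeightedDigraph N)
    (F : Fin N → Matrix (Fin n) (Fin n) ℝ) (G : ∀ i, Matrix (Fin n) (Fin (r i)) ℝ) : ENNReal :=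
  ∫⁻ t in Set.Ioi (0 : ℝ), ENNReal.ofReal
    (Matrix.trace ((S.impulseResponse g F G t)ᵀ * S.impulseResponse g F G t))

/-- `x`, `w₁, …, w_N` is a solution on `[0, ∞)`, under the disturbance `d`, of the plant together
with the distributed filter
`wᵢ' = A wᵢ + Gᵢ (yᵢ - Cᵢ wᵢ) + Fᵢ ∑ⱼ aᵢⱼ (wⱼ - wᵢ)`. -/
def IsTrajectory (S : Plant N n q p r) (g : WeightedDigraph N)
    (F : Fin N → Matrix (Fin n) (Fin n) ℝ) (G : ∀ i, Matrix (Fin n) (Fin (r i)) ℝ)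
    (d : ℝ → Fin q → ℝ) (x : ℝ → Fin n → ℝ) (w : Fin N → ℝ → Fin n → ℝ) : Prop :=
  ∀ t, 0 ≤ t →
    HasDerivWithinAt x (S.A *ᵥ x t + S.E *ᵥ d t) (Set.Ici 0) t ∧
    ∀ i, HasDerivWithinAt (w i)
      (S.A *ᵥ w i t + G i *ᵥ ((S.C i *ᵥ x t + S.D i *ᵥ d t) - S.C i *ᵥ w i t)
        + F i *ᵥ ∑ j, g.weight i j • (w j t - w i t)) (Set.Ici 0) t

/-- The distributed filter with gains `Fᵢ`, `Gᵢ` is H₂ `γ`-suboptimal: without disturbance all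
local filter states converge to the state of the plant, for all initial conditions, and the
H₂ cost is smaller than `γ`. -/
def IsH2Suboptimal (S : Plant N n q p r) (g : WeightedDigraph N)
    (F : Fin N → Matrix (Fin n) (Fin n) ℝ) (G : ∀ i, Matrix (Fin n) (Fin (r i)) ℝ) (γ : ℝ) :
    Prop :=
  (∀ x w, S.IsTrajectory g F G (fun _ => 0) x w →
    ∀ i, Filter.Tendsto (fun t => x t - w i t) Filter.atTop (nhds 0)) ∧
  S.h2Cost g F G < ENNReal.ofReal γ

end Plant

/-! The error e = col(x - wᵢ) admits the storage function eᵀXe with X = blockdiag(Xᵢ), Xᵢ = Tᵢ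
diag(Pᵢ₁, I) Tᵢᵀ. The gain Fᵢ is chosen so that Xᵢ Fᵢ = κθᵢ I. Hence the coupling enters the
derivative of eᵀXe only through -κ eᵀ(𝓛 ⊗ I)e.

Write xᵢ, yᵢ for the first and last coordinates of Tᵢᵀeᵢ. The Lyapunov equation for Pᵢ₁ governs xᵢ,
the κ-inequality governs yᵢ, and Young's inequality with weight κε splits the cross term. This gives
`local_dissipation`: the uncoupled derivative plus |Heᵢ|² is at most κε|eᵢ|² - κ|xᵢ|². The
ε-inequality says ε|e|² < eᵀ(𝓛 ⊗ I)e + Σ|xᵢ|² for e ≠ 0. Summing, `global_dissipation` obtains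
d/dt(eᵀXe) + |(I ⊗ H)e|² < 0. Therefore the error matrix is Hurwitz, and integration bounds J by
tr(ĒᵀXĒ), which is the sum of the trace terms.

Solvability of the steps rests on the following facts. The vector θ is a Perron vector of the graph.
The ε-inequality holds because a zero of its form is the same vector at every node and lies in every
undetectable subspace, so it is zero by detectability of the stacked pair (`pos_of_isDetectable`).
The Riccati inequality is obtained by separation (`exists_posForm_of_isDetectable`): an obstruction
would be a matrix W ≥ 0, W ≠ 0, with AW + WAᵀ ≥ 0 and CW = 0. The range of such a W is A-invariant,
carries only eigenvalues in the closed right half-plane and lies in ker C, so detectability excludes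
it (`eq_zero_of_isDetectable`). The Riccati inequality makes A₁₁ - G₁C₁ stable, which makes the
Lyapunov equation uniquely solvable. -/

/-! ### The positive left null vector and the quadratic form of the Laplacian. -/

namespace WeightedDigraph

variable {N : ℕ} (g : WeightedDigraph N)

theorem vecMul_laplacian_apply (θ : Fin N → ℝ) (j : Fin N) :
    (θ ᵥ* g.laplacian) j = θ j * ∑ k, g.weight j k - ∑ i, θ i * g.weight i j := by
  rw [laplacian, Matrix.vecMul_sub, Pi.sub_apply, Matrix.vecMul_diagonal]
  rfl

theorem vecMul_laplacian_eq_zero_iff (θ : Fin N → ℝ) :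
    θ ᵥ* g.laplacian = 0 ↔ ∀ j, θ j * ∑ k, g.weight j k = ∑ i, θ i * g.weight i j := by
  rw [funext_iff]
  refine forall_congr' fun j => ?_
  rw [vecMul_laplacian_apply, Pi.zero_apply, sub_eq_zero]

/-- The triangle inequality gives ≤ in the balance equation at every node. Both sides have the same
total over all nodes, so each inequality is an equality. -/
theorem vecMul_laplacian_abs {θ : Fin N → ℝ} (h : θ ᵥ* g.laplacian = 0) :
    (fun i => |θ i|) ᵥ* g.laplacian = 0 := by
  rw [vecMul_laplacian_eq_zero_iff] at h ⊢
  have hle : ∀ j ∈ Finset.univ,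
      |θ j| * ∑ k, g.weight j k ≤ ∑ i, |θ i| * g.weight i j := by
    intro j _
    rw [← abs_of_nonneg (Finset.sum_nonneg fun k _ => g.weight_nonneg j k), ← abs_mul, h j]
    refine (Finset.abs_sum_le_sum_abs _ _).trans_eq (Finset.sum_congr rfl fun i _ => ?_)
    rw [abs_mul, abs_of_nonneg (g.weight_nonneg i j)]
  have hsum : ∑ j, |θ j| * ∑ k, g.weight j k = ∑ j, ∑ i, |θ i| * g.weight i j := by
    rw [Finset.sum_comm]
    simp_rw [Finset.mul_sum]
  intro j
  exact (Finset.sum_eq_sum_iff_of_le hle).1 hsum j (Finset.mem_univ j)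

variable {g}

/-- At a zero of θ the balance equation is a vanishing sum of nonnegative terms, so zeros spread
along edges. -/
theorem eq_zero_of_nonneg_of_apply_eq_zero (hg : g.StronglyConnected) {θ : Fin N → ℝ}
    (h : θ ᵥ* g.laplacian = 0) (h0 : ∀ i, 0 ≤ θ i) {j : Fin N} (hj : θ j = 0) (i : Fin N) :
    θ i = 0 := by
  rw [vecMul_laplacian_eq_zero_iff] at h
  have step : ∀ a b, g.Edge a b → θ a = 0 → θ b = 0 := by
    intro a b hab ha
    have := h a
    rw [ha, zero_mul, eq_comm, Finset.sum_eq_zero_iff_of_nonneg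
      fun i _ => mul_nonneg (h0 i) (g.weight_nonneg i a)] at this
    exact (mul_eq_zero.1 (this b (Finset.mem_univ b))).resolve_right hab
  by_cases hij : j = i
  · exact hij ▸ hj
  · have := hg j i hij
    clear hij
    induction this with
    | single e => exact step _ _ e hj
    | tail _ e ih => exact step _ _ e ih

/-- Otherwise θ takes both signs, and |θ| + θ is a nonnegative null vector that vanishes at a
negative entry of θ but not at a positive one. -/
theorem eq_zero_of_sum_eq_zero (hg : g.StronglyConnected) {θ : Fin N → ℝ}
    (h : θ ᵥ* g.laplacian = 0) (hs : ∑ i, θ i = 0) : θ = 0 := by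
  by_contra hne
  obtain ⟨a, ha⟩ : ∃ a, 0 < θ a := by
    by_contra! hc
    exact hne (funext fun i =>
      (Finset.sum_eq_zero_iff_of_nonpos fun i _ => hc i).1 hs i (Finset.mem_univ i))
  obtain ⟨b, hb⟩ : ∃ b, θ b < 0 := by
    by_contra! hc
    exact ha.ne' ((Finset.sum_eq_zero_iff_of_nonneg fun i _ => hc i).1 hs a (Finset.mem_univ a))
  have h1 : ((fun i => |θ i|) + θ) ᵥ* g.laplacian = 0 := by
    rw [Matrix.add_vecMul, vecMul_laplacian_abs g h, h, add_zero]
  have h2 := eq_zero_of_nonneg_of_apply_eq_zero hg h1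
    (fun i => by have := neg_abs_le (θ i); simp only [Pi.add_apply]; linarith)
    (j := b) (by simp [abs_of_neg hb]) a
  simp only [Pi.add_apply, abs_of_pos ha] at h2
  linarith

theorem existsUnique_isLeftNullVector (hN : 0 < N) (hg : g.StronglyConnected) :
    ∃! θ : Fin N → ℝ, g.IsLeftNullVector θ := by
  have hne : Nonempty (Fin N) := ⟨⟨0, hN⟩⟩
  have hker : ∃ v : Fin N → ℝ, v ≠ 0 ∧ g.laplacian *ᵥ v = 0 := by
    refine ⟨1, one_ne_zero, funext fun i => ?_⟩
    simp [laplacian, Matrix.mulVec, dotProduct, Matrix.diagonal_apply]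
  -- Zero row sums make the determinant vanish, so there is a left null vector as well.
  obtain ⟨v, hv, hvL⟩ := Matrix.exists_vecMul_eq_zero_iff.2
    (Matrix.exists_mulVec_eq_zero_iff.1 hker)
  have habs := vecMul_laplacian_abs g hvL
  have hpos : ∀ i, 0 < |v i| := fun i => (abs_nonneg _).lt_of_ne fun h0 =>
    hv (funext fun k => abs_eq_zero.1
      (eq_zero_of_nonneg_of_apply_eq_zero hg habs (fun _ => abs_nonneg _) h0.symm k))
  have hS : 0 < ∑ i, |v i| := Finset.sum_pos (fun i _ => hpos i) Finset.univ_nonempty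
  refine ⟨((N : ℝ) / ∑ i, |v i|) • fun i => |v i|, ⟨fun i => ?_, ?_, ?_⟩, ?_⟩
  · have := hpos i
    simp only [Pi.smul_apply, smul_eq_mul]
    positivity
  · rw [Matrix.smul_vecMul, habs, smul_zero]
  · simp only [Pi.smul_apply, smul_eq_mul, ← Finset.mul_sum]
    field_simp
  · rintro θ ⟨-, hθ, hθs⟩
    refine sub_eq_zero.1 (eq_zero_of_sum_eq_zero hg ?_ ?_)
    · rw [Matrix.sub_vecMul, hθ, Matrix.smul_vecMul, habs, smul_zero, sub_zero]
    · simp only [Pi.sub_apply, Pi.smul_apply, smul_eq_mul, Finset.sum_sub_distrib, hθs,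
        ← Finset.mul_sum]
      field_simp
      simp

/-- The square (xᵢ - xⱼ)² differs from 2xᵢ(xᵢ - xⱼ) by xⱼ² - xᵢ², and the weighted total of this
difference vanishes because θL = 0. -/
theorem dotProduct_symLaplacian_mulVec {θ : Fin N → ℝ} (h : θ ᵥ* g.laplacian = 0)
    (x : Fin N → ℝ) :
    x ⬝ᵥ g.symLaplacian θ *ᵥ x = ∑ i, ∑ j, θ i * g.weight i j * (x i - x j) ^ 2 := by
  have hL : ∀ i, (g.laplacian *ᵥ x) i = ∑ j, g.weight i j * (x i - x j) := by
    intro i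
    rw [laplacian, Matrix.sub_mulVec, Pi.sub_apply, Matrix.mulVec_diagonal]
    simp only [mul_sub, Finset.sum_sub_distrib, ← Finset.sum_mul]
    rfl
  have h1 : x ⬝ᵥ (Matrix.diagonal θ * g.laplacian) *ᵥ x
      = ∑ i, ∑ j, θ i * g.weight i j * (x i * (x i - x j)) := by
    rw [← Matrix.mulVec_mulVec]
    simp only [dotProduct, Matrix.mulVec_diagonal, hL, Finset.mul_sum]
    exact Finset.sum_congr rfl fun i _ => Finset.sum_congr rfl fun j _ => by ring
  have h2 : x ⬝ᵥ (g.laplacianᵀ * Matrix.diagonal θ) *ᵥ x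
      = x ⬝ᵥ (Matrix.diagonal θ * g.laplacian) *ᵥ x := by
    rw [← Matrix.diagonal_transpose θ, ← Matrix.transpose_mul, Matrix.diagonal_transpose,
      Matrix.mulVec_transpose, dotProduct_comm, Matrix.dotProduct_mulVec]
  have h3 : ∑ i, ∑ j, θ i * g.weight i j * x i ^ 2 = ∑ i, ∑ j, θ i * g.weight i j * x j ^ 2 := by
    rw [vecMul_laplacian_eq_zero_iff] at h
    conv_rhs => rw [Finset.sum_comm]
    refine Finset.sum_congr rfl fun i _ => ?_
    rw [← Finset.sum_mul, ← Finset.sum_mul, ← Finset.mul_sum, h]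
  rw [symLaplacian, Matrix.add_mulVec, dotProduct_add, h2, h1]
  have h4 : ∑ i, ∑ j, θ i * g.weight i j * (x i - x j) ^ 2
      = (∑ i, ∑ j, θ i * g.weight i j * (x i * (x i - x j))
      + ∑ i, ∑ j, θ i * g.weight i j * (x i * (x i - x j)))
      + (∑ i, ∑ j, θ i * g.weight i j * x j ^ 2 - ∑ i, ∑ j, θ i * g.weight i j * x i ^ 2) := by
    simp only [← Finset.sum_add_distrib, ← Finset.sum_sub_distrib]
    exact Finset.sum_congr rfl fun i _ => Finset.sum_congr rfl fun j _ => by ring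
  rw [h4, h3, sub_self, add_zero]

theorem dotProduct_symLaplacian_mulVec_nonneg {θ : Fin N → ℝ} (h : g.IsLeftNullVector θ)
    (x : Fin N → ℝ) : 0 ≤ x ⬝ᵥ g.symLaplacian θ *ᵥ x := by
  rw [dotProduct_symLaplacian_mulVec h.2.1]
  exact Finset.sum_nonneg fun i _ => Finset.sum_nonneg fun j _ =>
    mul_nonneg (mul_nonneg (h.1 i).le (g.weight_nonneg i j)) (sq_nonneg _)

theorem apply_eq_of_dotProduct_symLaplacian_mulVec_eq_zero (hg : g.StronglyConnected)
    {θ : Fin N → ℝ} (h : g.IsLeftNullVector θ) {x : Fin N → ℝ}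
    (hx : x ⬝ᵥ g.symLaplacian θ *ᵥ x = 0) (i j : Fin N) : x i = x j := by
  rw [dotProduct_symLaplacian_mulVec h.2.1] at hx
  have hnn : ∀ i j, 0 ≤ θ i * g.weight i j * (x i - x j) ^ 2 := fun i j =>
    mul_nonneg (mul_nonneg (h.1 i).le (g.weight_nonneg i j)) (sq_nonneg _)
  have step : ∀ a b, g.Edge a b → x a = x b := by
    intro a b hab
    have h1 := (Finset.sum_eq_zero_iff_of_nonneg
      fun i _ => Finset.sum_nonneg fun j _ => hnn i j).1 hx b (Finset.mem_univ b)
    have h2 := (Finset.sum_eq_zero_iff_of_nonneg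
      fun j _ => hnn b j).1 h1 a (Finset.mem_univ a)
    have h3 : θ b * g.weight b a ≠ 0 := mul_ne_zero (h.1 b).ne' hab
    have h4 := pow_eq_zero_iff (two_ne_zero) |>.1 ((mul_eq_zero.1 h2).resolve_left h3)
    linarith
  by_cases hij : i = j
  · rw [hij]
  · have := hg i j hij
    clear hij
    induction this with
    | single e => exact step _ _ e
    | tail _ e ih => exact ih.trans (step _ _ e)

end WeightedDigraph

/-! ### Bounds for real quadratic forms. -/

namespace Matrix

variable {ι : Type*} [Fintype ι]

theorem posDef_real_iff {M : Matrix ι ι ℝ} :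
    M.PosDef ↔ Mᵀ = M ∧ ∀ x, x ≠ 0 → 0 < x ⬝ᵥ M *ᵥ x := by
  rw [posDef_iff_dotProduct_mulVec, IsHermitian, conjTranspose_eq_transpose_of_trivial]
  simp only [star_trivial]

theorem dotProduct_self_nonneg_real (x : ι → ℝ) : 0 ≤ x ⬝ᵥ x :=
  Finset.sum_nonneg fun i _ => mul_self_nonneg (x i)

theorem dotProduct_mulVec_transpose_comm {κ : Type*} [Fintype κ] (M : Matrix ι κ ℝ) (x : κ → ℝ)
    (y : ι → ℝ) : (M *ᵥ x) ⬝ᵥ y = x ⬝ᵥ Mᵀ *ᵥ y := by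
  rw [dotProduct_transpose_mulVec, dotProduct_comm]

/-- A crude bound for a bilinear form by the sum of the absolute values of its entries. -/
theorem abs_dotProduct_mulVec_le (M : Matrix ι ι ℝ) (x : ι → ℝ) :
    |x ⬝ᵥ M *ᵥ x| ≤ (∑ i, ∑ j, |M i j|) * (x ⬝ᵥ x) := by
  have hle : ∀ i, x i ^ 2 ≤ x ⬝ᵥ x := fun i => by
    rw [sq]
    exact Finset.single_le_sum (f := fun i => x i * x i) (fun i _ => mul_self_nonneg (x i))
      (Finset.mem_univ i)
  have hij : ∀ i j, |x i * x j| ≤ x ⬝ᵥ x := fun i j => by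
    rw [abs_le]
    have h1 := hle i
    have h2 := hle j
    constructor <;> nlinarith [sq_nonneg (x i + x j), sq_nonneg (x i - x j)]
  have hx : x ⬝ᵥ M *ᵥ x = ∑ i, ∑ j, x i * (M i j * x j) := by
    simp only [dotProduct, mulVec, Finset.mul_sum]
  rw [hx]
  refine (Finset.abs_sum_le_sum_abs _ _).trans ?_
  rw [Finset.sum_mul]
  refine Finset.sum_le_sum fun i _ => (Finset.abs_sum_le_sum_abs _ _).trans ?_
  rw [Finset.sum_mul]
  refine Finset.sum_le_sum fun j _ => ?_
  rw [show x i * (M i j * x j) = M i j * (x i * x j) by ring, abs_mul]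
  exact mul_le_mul_of_nonneg_left (hij i j) (abs_nonneg _)

theorem continuous_dotProduct_mulVec (M : Matrix ι ι ℝ) :
    Continuous fun x : ι → ℝ => x ⬝ᵥ M *ᵥ x := by
  simp only [dotProduct, mulVec]
  fun_prop

/-- A positive definite quadratic form is coercive. -/
theorem exists_coercive {M : Matrix ι ι ℝ} (h : ∀ x, x ≠ 0 → 0 < x ⬝ᵥ M *ᵥ x) :
    ∃ c : ℝ, 0 < c ∧ ∀ x, c * (x ⬝ᵥ x) ≤ x ⬝ᵥ M *ᵥ x := by
  have key : ∃ c : ℝ, 0 < c ∧ ∀ x, ‖x‖ = 1 → c ≤ x ⬝ᵥ M *ᵥ x := by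
    rcases (Metric.sphere (0 : ι → ℝ) 1).eq_empty_or_nonempty with he | hne
    · refine ⟨1, one_pos, fun x hx => ?_⟩
      exact absurd (he ▸ (by simpa using hx : x ∈ Metric.sphere (0 : ι → ℝ) 1))
        (Set.notMem_empty x)
    · obtain ⟨x₀, hx₀, hmin⟩ := (isCompact_sphere (0 : ι → ℝ) 1).exists_isMinOn hne
        (continuous_dotProduct_mulVec M).continuousOn
      refine ⟨_, h x₀ ?_, fun x hx => hmin (by simpa using hx)⟩
      rintro rfl
      simp at hx₀
  obtain ⟨c, hc, hmin⟩ := key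
  -- The minimum `c` refers to the sup norm; passing to `x ⬝ᵥ x` costs a factor of the dimension.
  -- The summand 1 keeps the denominator positive for an empty index type.
  refine ⟨c / (Fintype.card ι + 1), by positivity, fun x => ?_⟩
  by_cases hx : x = 0
  · simp [hx]
  have hn : 0 < ‖x‖ := norm_pos_iff.2 hx
  have h1 := hmin (‖x‖⁻¹ • x) (by rw [norm_smul, norm_inv, norm_norm, inv_mul_cancel₀ hn.ne'])
  rw [mulVec_smul, smul_dotProduct, dotProduct_smul, smul_eq_mul, smul_eq_mul] at h1
  have h2 : c * ‖x‖ ^ 2 ≤ x ⬝ᵥ M *ᵥ x := by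
    have := mul_le_mul_of_nonneg_right h1 (sq_nonneg ‖x‖)
    have h5 : ‖x‖⁻¹ * ‖x‖ = 1 := inv_mul_cancel₀ hn.ne'
    calc c * ‖x‖ ^ 2 ≤ _ := this
      _ = (‖x‖⁻¹ * ‖x‖) ^ 2 * (x ⬝ᵥ M *ᵥ x) := by ring
      _ = _ := by rw [h5]; ring
  have h3 : x ⬝ᵥ x ≤ (Fintype.card ι + 1) * ‖x‖ ^ 2 := by
    have : ∀ i ∈ Finset.univ, x i * x i ≤ ‖x‖ ^ 2 := fun i _ => by
      rw [← sq, ← sq_abs]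
      exact pow_le_pow_left₀ (abs_nonneg _) (norm_le_pi_norm x i) 2
    have := Finset.sum_le_card_nsmul _ _ _ this
    simp only [Finset.card_univ, nsmul_eq_mul] at this
    have h4 : x ⬝ᵥ x = ∑ i, x i * x i := rfl
    nlinarith [sq_nonneg ‖x‖]
  have hcard : (0 : ℝ) < Fintype.card ι + 1 := by positivity
  calc c / (Fintype.card ι + 1) * (x ⬝ᵥ x)
      ≤ c / (Fintype.card ι + 1) * ((Fintype.card ι + 1) * ‖x‖ ^ 2) := by gcongr
    _ = c * ‖x‖ ^ 2 := by field_simp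
    _ ≤ _ := h2

/-- A symmetric positive semidefinite form vanishes at `x` only if `x` is in the kernel. -/
theorem mulVec_eq_zero_of_dotProduct_eq_zero {W : Matrix ι ι ℝ} (hs : Wᵀ = W)
    (hW : ∀ x, 0 ≤ x ⬝ᵥ W *ᵥ x) {x : ι → ℝ} (hx : x ⬝ᵥ W *ᵥ x = 0) : W *ᵥ x = 0 := by
  have hp : W.PosSemidef := PosSemidef.of_dotProduct_mulVec_nonneg
    (by rw [IsHermitian, conjTranspose_eq_transpose_of_trivial, hs]) (by simpa using hW)
  exact (hp.dotProduct_mulVec_zero_iff x).1 (by simpa using hx)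

end Matrix

/-! ### Lyapunov functions, the Lyapunov equation and output energy. -/

namespace Matrix

open Filter Topology

variable {ι : Type*} [Fintype ι]

theorem hasDerivWithinAt_dotProduct_mulVec (M : Matrix ι ι ℝ) {x y : ℝ → ι → ℝ} {x' y' : ι → ℝ}
    {s : Set ℝ} {t : ℝ} (hx : HasDerivWithinAt x x' s t) (hy : HasDerivWithinAt y y' s t) :
    HasDerivWithinAt (fun t => x t ⬝ᵥ M *ᵥ y t) (x' ⬝ᵥ M *ᵥ y t + x t ⬝ᵥ M *ᵥ y') s t := by
  rw [hasDerivWithinAt_pi] at hx hy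
  simp only [dotProduct, mulVec, ← Finset.sum_add_distrib]
  exact HasDerivWithinAt.fun_sum fun i _ =>
    (hx i).mul (HasDerivWithinAt.fun_sum fun j _ => (hy j).const_mul (M i j))

theorem lyapunov_dotProduct (K P : Matrix ι ι ℝ) (x y : ι → ℝ) :
    (K *ᵥ x) ⬝ᵥ P *ᵥ y + x ⬝ᵥ P *ᵥ (K *ᵥ y) = x ⬝ᵥ (Kᵀ * P + P * K) *ᵥ y := by
  rw [dotProduct_mulVec_transpose_comm, add_mulVec, dotProduct_add, mulVec_mulVec, mulVec_mulVec]

/-- Lyapunov's theorem: a strict quadratic Lyapunov function forces all solutions of `y' = K y` on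
the half-line to decay. -/
theorem tendsto_zero_of_lyapunov {K X : Matrix ι ι ℝ} (hX : ∀ x, x ≠ 0 → 0 < x ⬝ᵥ X *ᵥ x)
    (hK : ∀ x, x ≠ 0 → x ⬝ᵥ (Kᵀ * X + X * K) *ᵥ x < 0) {y : ℝ → ι → ℝ}
    (hy : ∀ t, 0 ≤ t → HasDerivWithinAt y (K *ᵥ y t) (Set.Ici 0) t) :
    Tendsto y atTop (𝓝 0) := by
  obtain ⟨a, ha, haX⟩ := exists_coercive hX
  obtain ⟨c, hc, hcK⟩ := exists_coercive (M := -(Kᵀ * X + X * K)) fun x hx => by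
    rw [neg_mulVec, dotProduct_neg]
    linarith [hK x hx]
  set b : ℝ := (∑ i, ∑ j, |X i j|) + 1 with hb
  have hb0 : 0 < b := by
    have : 0 ≤ ∑ i, ∑ j, |X i j| :=
      Finset.sum_nonneg fun i _ => Finset.sum_nonneg fun j _ => abs_nonneg _
    linarith
  have hbX : ∀ x, x ⬝ᵥ X *ᵥ x ≤ b * (x ⬝ᵥ x) := fun x => by
    have h1 := (le_abs_self _).trans (abs_dotProduct_mulVec_le X x)
    have h2 := dotProduct_self_nonneg_real x
    rw [hb]
    linarith
  set V : ℝ → ℝ := fun t => y t ⬝ᵥ X *ᵥ y t with hV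
  have hVd : ∀ t, 0 ≤ t → HasDerivWithinAt V (y t ⬝ᵥ (Kᵀ * X + X * K) *ᵥ y t) (Set.Ici 0) t :=
    fun t ht => by
      rw [← lyapunov_dotProduct]
      exact hasDerivWithinAt_dotProduct_mulVec X (hy t ht) (hy t ht)
  have hVle : ∀ t, y t ⬝ᵥ (Kᵀ * X + X * K) *ᵥ y t ≤ -(c / b) * V t := fun t => by
    have h1 := hcK (y t)
    rw [neg_mulVec, dotProduct_neg] at h1
    have h2 : c / b * V t ≤ c / b * (b * (y t ⬝ᵥ y t)) :=
      mul_le_mul_of_nonneg_left (hbX (y t)) (by positivity)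
    have h3 : c / b * (b * (y t ⬝ᵥ y t)) = c * (y t ⬝ᵥ y t) := by field_simp
    linarith
  -- Grönwall's argument: V' ≤ -(c/b)V, so V decays at least like exp(-(c/b)t).
  have hanti : AntitoneOn (fun t => Real.exp (c / b * t) * V t) (Set.Ici 0) := by
    have hd : ∀ t, 0 ≤ t → HasDerivWithinAt (fun t => Real.exp (c / b * t) * V t)
        (Real.exp (c / b * t) * (c / b) * V t
          + Real.exp (c / b * t) * (y t ⬝ᵥ (Kᵀ * X + X * K) *ᵥ y t)) (Set.Ici 0) t :=
      fun t ht => by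
        have he : HasDerivAt (fun t : ℝ => Real.exp (c / b * t))
            (Real.exp (c / b * t) * (c / b)) t := by
          simpa using ((hasDerivAt_id t).const_mul (c / b)).exp
        exact he.hasDerivWithinAt.mul (hVd t ht)
    refine antitoneOn_of_hasDerivWithinAt_nonpos (convex_Ici 0)
      (fun t ht => (hd t ht).continuousWithinAt)
      (fun t ht => (hd t (interior_subset ht)).mono interior_subset) fun t _ => ?_
    have h1 := hVle t
    have h2 := Real.exp_pos (c / b * t)
    nlinarith
  have hsq : Tendsto (fun t => y t ⬝ᵥ y t) atTop (𝓝 0) := by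
    have hlim : Tendsto (fun t => V 0 / a * Real.exp (-(c / b * t))) atTop (𝓝 0) := by
      have : Tendsto (fun t : ℝ => c / b * t) atTop atTop :=
        tendsto_id.const_mul_atTop (by positivity)
      simpa using (Real.tendsto_exp_neg_atTop_nhds_zero.comp this).const_mul (V 0 / a)
    refine tendsto_of_tendsto_of_tendsto_of_le_of_le' tendsto_const_nhds hlim
      (Eventually.of_forall fun t => dotProduct_self_nonneg_real _) ?_
    filter_upwards [eventually_ge_atTop (0 : ℝ)] with t ht
    have h1 := hanti (Set.mem_Ici.2 le_rfl) (Set.mem_Ici.2 ht) ht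
    simp only [mul_zero, Real.exp_zero, one_mul] at h1
    have h2 := haX (y t)
    have h3 : V t = Real.exp (-(c / b * t)) * (Real.exp (c / b * t) * V t) := by
      rw [← mul_assoc, ← Real.exp_add, neg_add_cancel, Real.exp_zero, one_mul]
    have h4 : V t ≤ Real.exp (-(c / b * t)) * V 0 := by
      rw [h3]
      exact mul_le_mul_of_nonneg_left h1 (Real.exp_pos _).le
    rw [div_mul_eq_mul_div, le_div_iff₀ ha]
    linarith
  rw [tendsto_pi_nhds]
  intro i
  have hi : Tendsto (fun t => (y t i) ^ 2) atTop (𝓝 0) := by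
    refine tendsto_of_tendsto_of_tendsto_of_le_of_le tendsto_const_nhds hsq
      (fun t => sq_nonneg _) fun t => ?_
    rw [sq]
    exact Finset.single_le_sum (f := fun i => y t i * y t i) (fun i _ => mul_self_nonneg (y t i))
      (Finset.mem_univ i)
  have := hi.sqrt
  simp only [Real.sqrt_sq_eq_abs, Real.sqrt_zero] at this
  exact (tendsto_zero_iff_abs_tendsto_zero _).2 this

theorem tendsto_dotProduct_mulVec_zero (P : Matrix ι ι ℝ) {x y : ℝ → ι → ℝ} {l : Filter ℝ}
    (hx : Tendsto x l (𝓝 0)) (hy : Tendsto y l (𝓝 0)) :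
    Tendsto (fun t => x t ⬝ᵥ P *ᵥ y t) l (𝓝 0) := by
  rw [tendsto_pi_nhds] at hx hy
  simp only [dotProduct, mulVec]
  have : Tendsto (fun t => ∑ i, x t i * ∑ j, P i j * y t j) l (𝓝 (∑ _i : ι, 0)) := by
    refine tendsto_finsetSum _ fun i _ => ?_
    have h2 : Tendsto (fun t => ∑ j, P i j * y t j) l (𝓝 (∑ _j : ι, 0)) :=
      tendsto_finsetSum _ fun j _ => by simpa using (hy j).const_mul (P i j)
    simpa using (hx i).mul h2
  simpa using this

variable [DecidableEq ι]

/-- For a complex eigenvector a + ib with eigenvalue z, the Lyapunov form summed over a and b equals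
2 Re z times the sum of the X-forms; symmetry of X cancels the terms in Im z. -/
theorem isHurwitz_of_lyapunov {K X : Matrix ι ι ℝ} (hs : Xᵀ = X)
    (hX : ∀ x, x ≠ 0 → 0 < x ⬝ᵥ X *ᵥ x)
    (hK : ∀ x, x ≠ 0 → x ⬝ᵥ (Kᵀ * X + X * K) *ᵥ x < 0) : IsHurwitz K := by
  intro z hz
  rw [← Matrix.spectrum_toLin', ← Module.End.hasEigenvalue_iff_mem_spectrum] at hz
  obtain ⟨v, hv, hv0⟩ := hz.exists_hasEigenvector
  rw [Module.End.mem_eigenspace_iff, toLin'_apply] at hv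
  set a : ι → ℝ := fun i => (v i).re with ha
  set b : ι → ℝ := fun i => (v i).im with hb
  have hKa : K *ᵥ a = z.re • a - z.im • b := by
    funext i
    have := congrArg Complex.re (congrFun hv i)
    simpa [mulVec, dotProduct, ha, hb] using this
  have hKb : K *ᵥ b = z.re • b + z.im • a := by
    funext i
    have := congrArg Complex.im (congrFun hv i)
    simpa [mulVec, dotProduct, ha, hb] using this
  have hsymm : b ⬝ᵥ X *ᵥ a = a ⬝ᵥ X *ᵥ b := by
    conv_lhs => rw [← hs]
    exact dotProduct_transpose_mulVec X b a
  have key : a ⬝ᵥ (Kᵀ * X + X * K) *ᵥ a + b ⬝ᵥ (Kᵀ * X + X * K) *ᵥ b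
      = 2 * z.re * (a ⬝ᵥ X *ᵥ a + b ⬝ᵥ X *ᵥ b) := by
    rw [← lyapunov_dotProduct, ← lyapunov_dotProduct, hKa, hKb]
    simp only [mulVec_add, mulVec_sub, mulVec_smul, dotProduct_add, dotProduct_sub,
      add_dotProduct, sub_dotProduct, smul_dotProduct, dotProduct_smul, smul_eq_mul, hsymm]
    ring
  have hnn : ∀ x, 0 ≤ x ⬝ᵥ X *ᵥ x ∧ x ⬝ᵥ (Kᵀ * X + X * K) *ᵥ x ≤ 0 := fun x => by
    by_cases hx : x = 0
    · simp [hx]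
    · exact ⟨(hX x hx).le, (hK x hx).le⟩
  by_contra! hre
  have hneg : a ⬝ᵥ (Kᵀ * X + X * K) *ᵥ a + b ⬝ᵥ (Kᵀ * X + X * K) *ᵥ b < 0 := by
    by_cases ha0 : a = 0
    · by_cases hb0 : b = 0
      · exact absurd (funext fun i => Complex.ext (congrFun ha0 i) (congrFun hb0 i)) hv0
      · linarith [hK b hb0, (hnn a).2]
    · linarith [hK a ha0, (hnn b).2]
  have h1 := (hnn a).1
  have h2 := (hnn b).1
  have : 0 ≤ 2 * z.re * (a ⬝ᵥ X *ᵥ a + b ⬝ᵥ X *ᵥ b) := by positivity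
  linarith

section Exp

attribute [local instance] Matrix.linftyOpNormedRing Matrix.linftyOpNormedAlgebra

theorem hasDerivAt_exp_smul_mulVec (K : Matrix ι ι ℝ) (v : ι → ℝ) (t : ℝ) :
    HasDerivAt (fun t : ℝ => NormedSpace.exp (t • K) *ᵥ v)
      (K *ᵥ (NormedSpace.exp (t • K) *ᵥ v)) t := by
  have h := hasDerivAt_exp_smul_const' (𝕂 := ℝ) K t
  rw [mulVec_mulVec]
  let φ : Matrix ι ι ℝ →L[ℝ] (ι → ℝ) :=
    LinearMap.toContinuousLinearMap ((Matrix.mulVecBilin ℝ ℝ).flip v)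
  exact φ.hasFDerivAt.comp_hasDerivAt t h

end Exp

theorem tendsto_exp_smul_mulVec_of_lyapunov {K X : Matrix ι ι ℝ}
    (hX : ∀ x, x ≠ 0 → 0 < x ⬝ᵥ X *ᵥ x)
    (hK : ∀ x, x ≠ 0 → x ⬝ᵥ (Kᵀ * X + X * K) *ᵥ x < 0) (v : ι → ℝ) :
    Tendsto (fun t : ℝ => NormedSpace.exp (t • K) *ᵥ v) atTop (𝓝 0) :=
  tendsto_zero_of_lyapunov hX hK fun t _ => (hasDerivAt_exp_smul_mulVec K v t).hasDerivWithinAt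

theorem hasDerivAt_dotProduct_exp (K P : Matrix ι ι ℝ) (v w : ι → ℝ) (t : ℝ) :
    HasDerivAt (fun t : ℝ => (NormedSpace.exp (t • K) *ᵥ v) ⬝ᵥ P *ᵥ (NormedSpace.exp (t • K) *ᵥ w))
      ((NormedSpace.exp (t • K) *ᵥ v) ⬝ᵥ (Kᵀ * P + P * K) *ᵥ (NormedSpace.exp (t • K) *ᵥ w)) t := by
  rw [← lyapunov_dotProduct, ← hasDerivWithinAt_univ]
  exact hasDerivWithinAt_dotProduct_mulVec P (hasDerivAt_exp_smul_mulVec K v t).hasDerivWithinAt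
    (hasDerivAt_exp_smul_mulVec K w t).hasDerivWithinAt

theorem tendsto_dotProduct_exp {K : Matrix ι ι ℝ}
    (hK : ∀ v, Tendsto (fun t : ℝ => NormedSpace.exp (t • K) *ᵥ v) atTop (𝓝 0))
    (P : Matrix ι ι ℝ) (v w : ι → ℝ) :
    Tendsto (fun t : ℝ => (NormedSpace.exp (t • K) *ᵥ v) ⬝ᵥ P *ᵥ (NormedSpace.exp (t • K) *ᵥ w))
      atTop (𝓝 0) :=
  tendsto_dotProduct_mulVec_zero P (hK v) (hK w)

/-- The bilinear form of P is constant along pairs of solutions, which tend to zero. -/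
theorem eq_zero_of_lyapunov_eq_zero {K : Matrix ι ι ℝ}
    (hK : ∀ v, Tendsto (fun t : ℝ => NormedSpace.exp (t • K) *ᵥ v) atTop (𝓝 0))
    {P : Matrix ι ι ℝ} (hP : Kᵀ * P + P * K = 0) : P = 0 := by
  have h0 : ∀ v w : ι → ℝ, v ⬝ᵥ P *ᵥ w = 0 := by
    intro v w
    have hconst : ∀ t : ℝ, (NormedSpace.exp (t • K) *ᵥ v) ⬝ᵥ P *ᵥ (NormedSpace.exp (t • K) *ᵥ w)
        = v ⬝ᵥ P *ᵥ w := by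
      intro t
      have hd := fun s => hasDerivAt_dotProduct_exp K P v w s
      simp only [hP, zero_mulVec, dotProduct_zero] at hd
      have := is_const_of_deriv_eq_zero (fun s => (hd s).differentiableAt)
        (fun s => (hd s).deriv) t 0
      simpa using this
    have := tendsto_dotProduct_exp hK P v w
    simp only [hconst] at this
    exact tendsto_nhds_unique tendsto_const_nhds this
  ext i j
  simpa using h0 (Pi.single i 1) (Pi.single j 1)

/-- The Lyapunov equation `Kᵀ P + P K + R = 0` with exponentially stable `K` and `R > 0` has
exactly one positive definite solution. -/
theorem existsUnique_lyapunov {K R : Matrix ι ι ℝ}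
    (hK : ∀ v, Tendsto (fun t : ℝ => NormedSpace.exp (t • K) *ᵥ v) atTop (𝓝 0)) (hR : R.PosDef) :
    ∃! P : Matrix ι ι ℝ, P.PosDef ∧ Kᵀ * P + P * K + R = 0 := by
  let Λ : Matrix ι ι ℝ →ₗ[ℝ] Matrix ι ι ℝ :=
    LinearMap.mulLeft ℝ Kᵀ + LinearMap.mulRight ℝ K
  have hΛ : ∀ P, Λ P = Kᵀ * P + P * K := fun P => rfl
  have hinj : Function.Injective Λ := by
    rw [injective_iff_map_eq_zero]
    exact fun P hP => eq_zero_of_lyapunov_eq_zero hK hP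
  obtain ⟨P, hP⟩ := LinearMap.injective_iff_surjective.1 hinj (-R)
  rw [hΛ] at hP
  rw [posDef_real_iff] at hR
  -- The transpose solves the same equation, so uniqueness gives symmetry.
  have hPs : Pᵀ = P := hinj (by
    rw [hΛ, hΛ, hP]
    have := congrArg transpose hP
    simp only [transpose_add, transpose_mul, transpose_transpose, transpose_neg, hR.1] at this
    rw [← this, add_comm])
  have hnn : ∀ x, 0 ≤ x ⬝ᵥ P *ᵥ x := by
    intro x
    have hd := fun t => hasDerivAt_dotProduct_exp K P x x t
    have hanti : Antitone fun t : ℝ =>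
        (NormedSpace.exp (t • K) *ᵥ x) ⬝ᵥ P *ᵥ (NormedSpace.exp (t • K) *ᵥ x) := by
      refine antitone_of_hasDerivAt_nonpos hd fun t => ?_
      rw [hP, neg_mulVec, dotProduct_neg]
      by_cases h0 : NormedSpace.exp (t • K) *ᵥ x = 0
      · simp [h0]
      · exact (neg_neg_of_pos (hR.2 _ h0)).le
    have := hanti.le_of_tendsto (tendsto_dotProduct_exp hK P x x) 0
    simpa using this
  refine ⟨P, ⟨posDef_real_iff.2 ⟨hPs, fun x hx => ?_⟩, by rw [hP, neg_add_cancel]⟩, ?_⟩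
  -- If the form vanished at x then Px = 0, and the equation tested at x would give xᵀRx = 0.
  · refine (hnn x).lt_of_ne fun h0 => ?_
    have h1 := mulVec_eq_zero_of_dotProduct_eq_zero hPs hnn h0.symm
    have h2 := lyapunov_dotProduct K P x x
    rw [hP, neg_mulVec, dotProduct_neg, h1, dotProduct_zero, zero_add, ← hPs,
      dotProduct_transpose_mulVec, h1, dotProduct_zero] at h2
    linarith [hR.2 x hx]
  · rintro P' ⟨-, hP'⟩
    exact hinj (by rw [hΛ, hΛ, hP, eq_neg_of_add_eq_zero_left hP'])

/-- The output energy of an exponentially stable system is bounded by a quadratic storage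
function. -/
theorem lintegral_exp_output_le {μ : Type*} [Fintype μ] {K P : Matrix ι ι ℝ} {C : Matrix μ ι ℝ}
    (hK : ∀ v, Tendsto (fun t : ℝ => NormedSpace.exp (t • K) *ᵥ v) atTop (𝓝 0))
    (hP : ∀ x, x ⬝ᵥ (Kᵀ * P + P * K) *ᵥ x + (C *ᵥ x) ⬝ᵥ (C *ᵥ x) ≤ 0) (v : ι → ℝ) :
    ∫⁻ t in Set.Ioi (0 : ℝ), ENNReal.ofReal ((C *ᵥ (NormedSpace.exp (t • K) *ᵥ v)) ⬝ᵥ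
      (C *ᵥ (NormedSpace.exp (t • K) *ᵥ v))) ≤ ENNReal.ofReal (v ⬝ᵥ P *ᵥ v) := by
  set y : ℝ → ι → ℝ := fun t => NormedSpace.exp (t • K) *ᵥ v with hy
  have hd : ∀ t, HasDerivAt (fun t => y t ⬝ᵥ P *ᵥ y t)
    (y t ⬝ᵥ (Kᵀ * P + P * K) *ᵥ y t) t := fun t => hasDerivAt_dotProduct_exp K P v v t
  have hle : ∀ t, (C *ᵥ y t) ⬝ᵥ (C *ᵥ y t) ≤ -(y t ⬝ᵥ (Kᵀ * P + P * K) *ᵥ y t) := fun t => by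
    linarith [hP (y t)]
  have hneg : ∀ t ∈ Set.Ioi (0 : ℝ), y t ⬝ᵥ (Kᵀ * P + P * K) *ᵥ y t ≤ 0 := fun t _ => by
    linarith [hle t, dotProduct_self_nonneg_real (C *ᵥ y t)]
  have hlim := tendsto_dotProduct_exp hK P v v
  -- The storage is monotone with limit zero, so its derivative is integrable and the total decrease
  -- equals the initial value.
  have hint := MeasureTheory.integrableOn_Ioi_deriv_of_nonpos' (fun t _ => hd t) hneg hlim
  have hval := MeasureTheory.integral_Ioi_of_hasDerivAt_of_nonpos' (fun t _ => hd t) hneg hlim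
  calc _ ≤ ∫⁻ t in Set.Ioi (0 : ℝ), ENNReal.ofReal (-(y t ⬝ᵥ (Kᵀ * P + P * K) *ᵥ y t)) :=
        MeasureTheory.lintegral_mono fun t => ENNReal.ofReal_le_ofReal (hle t)
    _ = ENNReal.ofReal (∫ t in Set.Ioi (0 : ℝ), -(y t ⬝ᵥ (Kᵀ * P + P * K) *ᵥ y t)) := by
        refine (MeasureTheory.ofReal_integral_eq_lintegral_ofReal hint.neg ?_).symm
        exact (MeasureTheory.ae_restrict_iff' measurableSet_Ioi).2
          (Eventually.of_forall fun t ht => neg_nonneg.2 (hneg t ht))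
    _ = ENNReal.ofReal (v ⬝ᵥ P *ᵥ v) := by
        rw [MeasureTheory.integral_neg, hval]
        simp [hy]

end Matrix

/-! ### The unstable factor and the undetectable subspace. -/

section UnstableFactor

variable {ι : Type*} [Fintype ι] [DecidableEq ι]

theorem zero_le_re_of_aeval_multiset_prod {s : Multiset ℝ[X]}
    (hs : ∀ f ∈ s, ∀ z : ℂ, aeval z f = 0 → 0 ≤ z.re) {z : ℂ} (hz : aeval z s.prod = 0) :
    0 ≤ z.re := by
  rw [map_multiset_prod, Multiset.prod_eq_zero_iff, Multiset.mem_map] at hz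
  obtain ⟨f, hf, hfz⟩ := hz
  exact hs f hf z hfz

theorem zero_le_re_of_aeval_unstableFactor (A : Matrix ι ι ℝ) {z : ℂ}
    (hz : aeval z (unstableFactor A) = 0) : 0 ≤ z.re := by
  classical
  rw [unstableFactor] at hz
  exact zero_le_re_of_aeval_multiset_prod (fun f hf => (Multiset.mem_filter.1 hf).2) hz

/-- The complementary factor of the characteristic polynomial: a product of irreducible factors
that have a root in the open left half-plane. -/
theorem exists_stable_factors (A : Matrix ι ι ℝ) :
    ∃ s : Multiset ℝ[X], (∀ f ∈ s, Irreducible f ∧ ∃ z : ℂ, aeval z f = 0 ∧ z.re < 0) ∧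
      aeval A (s.prod * unstableFactor A) = 0 := by
  classical
  refine ⟨(UniqueFactorizationMonoid.normalizedFactors A.charpoly).filter
    (fun f => ¬ ∀ z : ℂ, aeval z f = 0 → 0 ≤ z.re), fun f hf => ?_, ?_⟩
  · rw [Multiset.mem_filter] at hf
    refine ⟨UniqueFactorizationMonoid.irreducible_of_normalized_factor f hf.1, ?_⟩
    simpa only [not_forall, not_le, exists_prop] using hf.2
  · have hp := UniqueFactorizationMonoid.prod_normalizedFactors
      (A.charpoly_monic.ne_zero)
    rw [unstableFactor, mul_comm, ← Multiset.prod_add]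
    have : ∀ s : Multiset ℝ[X], ∀ P : ℝ[X] → Prop, ∀ [DecidablePred P],
      s.filter P + s.filter (fun f => ¬ P f) = s := fun s P _ => Multiset.filter_add_not P s
    convert_to aeval A (UniqueFactorizationMonoid.normalizedFactors A.charpoly).prod = 0
    · congr 2
      convert this _ (fun f => ∀ z : ℂ, aeval z f = 0 → 0 ≤ z.re)
    · obtain ⟨u, hu⟩ := hp.symm
      rw [← hu, map_mul, aeval_self_charpoly, zero_mul]

/-- An irreducible factor dividing q would hand its root in the open left half-plane to q. -/
theorem isCoprime_stable_factors {s : Multiset ℝ[X]}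
    (hs : ∀ f ∈ s, Irreducible f ∧ ∃ z : ℂ, aeval z f = 0 ∧ z.re < 0) {q : ℝ[X]}
    (hq : ∀ z : ℂ, aeval z q = 0 → 0 ≤ z.re) : IsCoprime s.prod q := by
  induction s using Multiset.induction with
  | empty => simpa using isCoprime_one_left
  | cons f s ih =>
    rw [Multiset.prod_cons]
    refine IsCoprime.mul_left ?_ (ih fun f hf => hs f (Multiset.mem_cons_of_mem hf))
    obtain ⟨hf, z, hz, hre⟩ := hs f (Multiset.mem_cons_self f s)
    rw [hf.coprime_iff_not_dvd]
    rintro ⟨g, rfl⟩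
    exact hre.not_ge (hq z (by rw [map_mul, hz, zero_mul]))

/-- A vector annihilated by `q(A)`, where all roots of `q` lie in the closed right half-plane, is
annihilated by `p₊(A)`. -/
theorem aeval_unstableFactor_mulVec_eq_zero {A : Matrix ι ι ℝ} {q : ℝ[X]}
    (hq : ∀ z : ℂ, aeval z q = 0 → 0 ≤ z.re) {x : ι → ℝ} (hx : aeval A q *ᵥ x = 0) :
    aeval A (unstableFactor A) *ᵥ x = 0 := by
  obtain ⟨s, hs, hA⟩ := exists_stable_factors A
  obtain ⟨u, w, huw⟩ := isCoprime_stable_factors hs hq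
  -- Bézout's identity multiplied by p₊: the first summand vanishes at A by Cayley–Hamilton, the
  -- second annihilates x.
  have h1 : unstableFactor A = u * (s.prod * unstableFactor A) + (w * unstableFactor A) * q := by
    linear_combination (-unstableFactor A) * huw
  rw [h1, map_add, map_mul, hA, mul_zero, zero_add, map_mul, ← mulVec_mulVec, hx, mulVec_zero]

theorem aeval_intertwine {κ : Type*} [Fintype κ] [DecidableEq κ] {A : Matrix ι ι ℝ}
    {B : Matrix κ κ ℝ} {R : Matrix κ ι ℝ} (h : R * A = B * R) (f : ℝ[X]) :
    R * aeval A f = aeval B f * R := by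
  induction f using Polynomial.induction_on' with
  | add p q hp hq => rw [map_add, map_add, Matrix.mul_add, Matrix.add_mul, hp, hq]
  | monomial k a =>
    have hk : R * A ^ k = B ^ k * R := by
      induction k with
      | zero => simp
      | succ k ih => rw [pow_succ, ← Matrix.mul_assoc, ih, Matrix.mul_assoc, h, pow_succ,
          Matrix.mul_assoc]
    simp only [aeval_monomial, Algebra.algebraMap_eq_smul_one, smul_mul_assoc, one_mul,
      Matrix.mul_smul, Matrix.smul_mul, hk]

theorem pow_intertwine {κ : Type*} [Fintype κ] [DecidableEq κ] {A : Matrix ι ι ℝ}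
    {B : Matrix κ κ ℝ} {R : Matrix κ ι ℝ} (h : R * A = B * R) (k : ℕ) :
    R * A ^ k = B ^ k * R := by
  simpa using aeval_intertwine h (X ^ k)

variable {μ : Type*}

/-- Reducing Xᵏ modulo the characteristic polynomial extends the condition from k < n to all k,
which makes invariance under A immediate. -/
theorem mem_undetectableSubspace_iff {C : Matrix μ ι ℝ} {A : Matrix ι ι ℝ} {x : ι → ℝ} :
    x ∈ undetectableSubspace C A ↔
      (∀ k : ℕ, C *ᵥ (A ^ k *ᵥ x) = 0) ∧ aeval A (unstableFactor A) *ᵥ x = 0 := by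
  simp only [undetectableSubspace, Submodule.mem_inf, Submodule.mem_iInf, LinearMap.mem_ker,
    mulVecLin_apply]
  refine and_congr_left fun _ => ⟨fun h k => ?_, fun h k => ?_⟩
  · rw [Matrix.pow_eq_aeval_mod_charpoly, aeval_eq_sum_range]
    rcases isEmpty_or_nonempty ι with hι | hι
    · rw [show x = 0 from Subsingleton.elim _ _, mulVec_zero, mulVec_zero]
    rw [Matrix.sum_mulVec, Matrix.mulVec_sum]
    refine Finset.sum_eq_zero fun j hj => ?_
    have hlt : j < Fintype.card ι := by
      have h1 : (X ^ k %ₘ A.charpoly).natDegree < A.charpoly.natDegree := by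
        refine natDegree_modByMonic_lt _ A.charpoly_monic fun h1 => ?_
        have := A.charpoly_natDegree_eq_dim
        rw [h1, natDegree_one] at this
        exact Fintype.card_ne_zero this.symm
      rw [A.charpoly_natDegree_eq_dim] at h1
      have := Finset.mem_range.1 hj
      omega
    have := h ⟨j, hlt⟩
    rw [smul_mulVec, mulVec_smul, mulVec_mulVec, this, smul_zero]
  · rw [← mulVec_mulVec]
    exact h k

theorem isDetectable_iff {C : Matrix μ ι ℝ} {A : Matrix ι ι ℝ} :
    IsDetectable C A ↔ ∀ x, (∀ k : ℕ, C *ᵥ (A ^ k *ᵥ x) = 0) →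
      aeval A (unstableFactor A) *ᵥ x = 0 → x = 0 := by
  rw [IsDetectable, Submodule.eq_bot_iff]
  simp only [mem_undetectableSubspace_iff, and_imp]

theorem mulVec_mem_undetectableSubspace {C : Matrix μ ι ℝ} {A : Matrix ι ι ℝ} {x : ι → ℝ}
    (hx : x ∈ undetectableSubspace C A) : A *ᵥ x ∈ undetectableSubspace C A := by
  rw [mem_undetectableSubspace_iff] at hx ⊢
  refine ⟨fun k => ?_, ?_⟩
  · rw [mulVec_mulVec _ (A ^ k) A, ← pow_succ]
    exact hx.1 (k + 1)
  · have : aeval A (unstableFactor A) * A = A * aeval A (unstableFactor A) := by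
      have := congrArg (aeval A) (mul_comm (unstableFactor A) X)
      simpa using this
    rw [mulVec_mulVec, this, ← mulVec_mulVec, hx.2, mulVec_zero]

theorem mulVec_eq_zero_of_mem_undetectableSubspace {C : Matrix μ ι ℝ} {A : Matrix ι ι ℝ}
    {x : ι → ℝ} (hx : x ∈ undetectableSubspace C A) : C *ᵥ x = 0 := by
  simpa using (mem_undetectableSubspace_iff.1 hx).1 0

variable {κ : Type*} [Fintype κ] [DecidableEq κ]

/-- The quotient of a system by its undetectable subspace is detectable. -/
theorem isDetectable_of_ker_eq {C : Matrix μ ι ℝ} {A : Matrix ι ι ℝ} {R : Matrix κ ι ℝ}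
    {A₁ : Matrix κ κ ℝ} {C₁ : Matrix μ κ ℝ} (hA : R * A = A₁ * R) (hC : C = C₁ * R)
    (hR : R * Rᵀ = 1) (hker : ∀ x, R *ᵥ x = 0 ↔ x ∈ undetectableSubspace C A) :
    IsDetectable C₁ A₁ := by
  rw [isDetectable_iff]
  intro y hy hpy
  set x := Rᵀ *ᵥ y with hx
  have hRx : R *ᵥ x = y := by rw [hx, mulVec_mulVec, hR, one_mulVec]
  have hq : aeval A (unstableFactor A₁) *ᵥ x ∈ undetectableSubspace C A := by
    rw [← hker, mulVec_mulVec, aeval_intertwine hA, ← mulVec_mulVec, hRx, hpy]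
  rw [← hRx, hker, mem_undetectableSubspace_iff]
  refine ⟨fun k => ?_, ?_⟩
  · rw [hC, ← mulVec_mulVec, mulVec_mulVec _ R, pow_intertwine hA, ← mulVec_mulVec _ _ R, hRx, hy]
  -- The vector p₊(A₁)y = 0 lifts to p₊(A₁)(A)x in the undetectable subspace, which p₊(A)
  -- annihilates. The product still has its roots in the closed right half-plane.
  · refine aeval_unstableFactor_mulVec_eq_zero (q := unstableFactor A * unstableFactor A₁)
      (fun z hz => ?_) ?_
    · rw [map_mul, mul_eq_zero] at hz
      exact hz.elim (zero_le_re_of_aeval_unstableFactor A) (zero_le_re_of_aeval_unstableFactor A₁)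
    · rw [map_mul, ← mulVec_mulVec]
      exact (mem_undetectableSubspace_iff.1 hq).2

theorem mulVec_eq_zero_of_isDetectable {C : Matrix μ ι ℝ} {A : Matrix ι ι ℝ} {R : Matrix κ ι ℝ}
    {A₁ : Matrix κ κ ℝ} {C₁ : Matrix μ κ ℝ} (hA : R * A = A₁ * R) (hC : C = C₁ * R)
    (hd : IsDetectable C₁ A₁) {x : ι → ℝ} (hx : x ∈ undetectableSubspace C A) : R *ᵥ x = 0 := by
  rw [mem_undetectableSubspace_iff] at hx
  refine isDetectable_iff.1 hd _ (fun k => ?_) ?_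
  · rw [mulVec_mulVec _ _ R, ← pow_intertwine hA, ← mulVec_mulVec, mulVec_mulVec, ← hC, hx.1]
  · refine aeval_unstableFactor_mulVec_eq_zero
      (fun z hz => zero_le_re_of_aeval_unstableFactor A hz) ?_
    rw [mulVec_mulVec, ← aeval_intertwine hA, ← mulVec_mulVec, hx.2, mulVec_zero]

end UnstableFactor

/-! ### Existence and rigidity of the detectability decomposition. -/

namespace Matrix

variable {ι α β μ : Type*} [Fintype ι] [Fintype α] [Fintype β]

theorem toRows₁_transpose_mul_of_toBlocks₁₂ [DecidableEq ι] {T : Matrix ι (α ⊕ β) ℝ}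
    {A : Matrix ι ι ℝ} (hT : T * Tᵀ = 1) (h : (Tᵀ * A * T).toBlocks₁₂ = 0) :
    Tᵀ.toRows₁ * A = (Tᵀ * A * T).toBlocks₁₁ * Tᵀ.toRows₁ := by
  have h1 : Tᵀ * A = (Tᵀ * A * T) * Tᵀ := by
    rw [Matrix.mul_assoc (Tᵀ * A), hT, Matrix.mul_one]
  ext a i
  have h2 := congrFun (congrFun h1 (Sum.inl a)) i
  rw [Matrix.mul_apply (M := Tᵀ * A * T), Fintype.sum_sum_type] at h2
  have h3 : ∀ b, (Tᵀ * A * T) (Sum.inl a) (Sum.inr b) = 0 := fun b => congrFun (congrFun h a) b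
  simp only [h3, zero_mul, Finset.sum_const_zero, add_zero] at h2
  exact h2

theorem eq_toCols₁_mul_of_toCols₂ [DecidableEq ι] {T : Matrix ι (α ⊕ β) ℝ} {C : Matrix μ ι ℝ}
    (hT : T * Tᵀ = 1) (h : (C * T).toCols₂ = 0) : C = (C * T).toCols₁ * Tᵀ.toRows₁ := by
  have h1 : C = (C * T) * Tᵀ := by rw [Matrix.mul_assoc, hT, Matrix.mul_one]
  ext a i
  have h2 := congrFun (congrFun h1 a) i
  rw [Matrix.mul_apply (M := C * T), Fintype.sum_sum_type] at h2
  have h3 : ∀ b, (C * T) a (Sum.inr b) = 0 := fun b => congrFun (congrFun h a) b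
  simp only [h3, zero_mul, Finset.sum_const_zero, add_zero] at h2
  exact h2

theorem toRows₁_transpose_mul_self {γ δ : Type*} [DecidableEq γ] [DecidableEq δ]
    {T : Matrix ι (γ ⊕ δ) ℝ}
    (hT : Tᵀ * T = 1) : Tᵀ.toRows₁ * Tᵀ.toRows₁ᵀ = 1 := by
  ext a b
  have := congrFun (congrFun hT (Sum.inl a)) (Sum.inl b)
  simpa [Matrix.mul_apply, Matrix.one_apply] using this

end Matrix

namespace DetectabilityDecomposition

variable {n s : ℕ} {C : Matrix (Fin s) (Fin n) ℝ} {A : Matrix (Fin n) (Fin n) ℝ}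

/-- In every detectability decomposition the first columns of `T` span the orthogonal complement
of the undetectable subspace. -/
theorem toRows₁_mulVec_eq_zero_iff (d : DetectabilityDecomposition C A) (x : Fin n → ℝ) :
    d.Tᵀ.toRows₁ *ᵥ x = 0 ↔ x ∈ undetectableSubspace C A := by
  set R := d.Tᵀ.toRows₁ with hR
  have hA := toRows₁_transpose_mul_of_toBlocks₁₂ d.mul_transpose_self d.toBlocks₁₂_eq_zero
  have hC := eq_toCols₁_mul_of_toCols₂ d.mul_transpose_self d.toCols₂_eq_zero
  have hRR := toRows₁_transpose_mul_self d.transpose_mul_self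
  have hle : undetectableSubspace C A ≤ LinearMap.ker R.mulVecLin := fun x hx =>
    mulVec_eq_zero_of_isDetectable hA hC d.detectable hx
  have hsurj : LinearMap.range R.mulVecLin = ⊤ := LinearMap.range_eq_top.2 fun y =>
    ⟨Rᵀ *ᵥ y, by rw [mulVecLin_apply, mulVec_mulVec, hR, hRR, one_mulVec]⟩
  have hrank := LinearMap.finrank_range_add_finrank_ker R.mulVecLin
  rw [hsurj, finrank_top, Module.finrank_fin_fun, Module.finrank_fin_fun] at hrank
  -- Detectability of the quotient gives one inclusion; the prescribed value of `v` makes the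
  -- dimensions agree.
  have heq := Submodule.eq_of_le_of_finrank_eq hle (by have := d.v_add_finrank; omega)
  rw [heq, LinearMap.mem_ker, mulVecLin_apply]

/-- The columns of T are orthonormal bases of Sᗮ and of S, where S is the undetectable subspace.
Invariance of S under A gives the zero block, and S ⊆ ker C gives the zero columns. -/
theorem nonempty (C : Matrix (Fin s) (Fin n) ℝ) (A : Matrix (Fin n) (Fin n) ℝ) :
    Nonempty (DetectabilityDecomposition C A) := by
  set S := undetectableSubspace C A with hS
  let e := (WithLp.linearEquiv 2 ℝ (Fin n → ℝ)).symm
  set S' : Submodule ℝ (EuclideanSpace ℝ (Fin n)) := S.map e.toLinearMap with hS'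
  have hfin : Module.finrank ℝ S' = Module.finrank ℝ S := LinearEquiv.finrank_map_eq e S
  have hadd := S'.finrank_add_finrank_orthogonal
  rw [finrank_euclideanSpace_fin, hfin] at hadd
  set v := n - Module.finrank ℝ S with hv
  let b₁ : OrthonormalBasis (Fin v) ℝ S'ᗮ := (stdOrthonormalBasis ℝ S'ᗮ).reindex
    (finCongr (by omega))
  let b₂ : OrthonormalBasis (Fin (n - v)) ℝ S' := (stdOrthonormalBasis ℝ S').reindex
    (finCongr (by omega))
  let T : Matrix (Fin n) (Fin v ⊕ Fin (n - v)) ℝ := Matrix.of fun i c =>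
    Sum.elim (fun a => (b₁ a : EuclideanSpace ℝ (Fin n)) i)
      (fun a => (b₂ a : EuclideanSpace ℝ (Fin n)) i) c
  have hmem : ∀ x : EuclideanSpace ℝ (Fin n), x ∈ S' ↔ x.ofLp ∈ S := fun x =>
    ⟨by rintro ⟨y, hy, rfl⟩; exact hy, fun h => ⟨x.ofLp, h, rfl⟩⟩
  have hinner : ∀ x y : EuclideanSpace ℝ (Fin n), x.ofLp ⬝ᵥ y.ofLp = inner ℝ x y := fun x y => by
    rw [EuclideanSpace.inner_eq_star_dotProduct, star_trivial, dotProduct_comm]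
  have h12 : ∀ (a) (y : EuclideanSpace ℝ (Fin n)), y.ofLp ∈ S →
      (b₁ a : EuclideanSpace ℝ (Fin n)).ofLp ⬝ᵥ y.ofLp = 0 := fun a y hy => by
    rw [hinner]
    exact Submodule.inner_left_of_mem_orthogonal ((hmem y).2 hy) (b₁ a).2
  have hb₂ : ∀ b, (b₂ b : EuclideanSpace ℝ (Fin n)).ofLp ∈ S := fun b => (hmem _).1 (b₂ b).2
  have hTT : Tᵀ * T = 1 := by
    ext c d
    rcases c with a | a <;> rcases d with b | b
    · change (b₁ a : EuclideanSpace ℝ (Fin n)).ofLp ⬝ᵥ (b₁ b : EuclideanSpace ℝ (Fin n)).ofLp = _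
      have := orthonormal_iff_ite.1 b₁.orthonormal a b
      rw [hinner, ← Submodule.coe_inner, this]
      simp [Matrix.one_apply]
    · change (b₁ a : EuclideanSpace ℝ (Fin n)).ofLp ⬝ᵥ (b₂ b : EuclideanSpace ℝ (Fin n)).ofLp = _
      rw [h12 _ _ (hb₂ b)]
      simp
    · change (b₂ a : EuclideanSpace ℝ (Fin n)).ofLp ⬝ᵥ (b₁ b : EuclideanSpace ℝ (Fin n)).ofLp = _
      rw [dotProduct_comm, h12 _ _ (hb₂ a)]
      simp
    · change (b₂ a : EuclideanSpace ℝ (Fin n)).ofLp ⬝ᵥ (b₂ b : EuclideanSpace ℝ (Fin n)).ofLp = _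
      have := orthonormal_iff_ite.1 b₂.orthonormal a b
      rw [hinner, ← Submodule.coe_inner, this]
      simp [Matrix.one_apply]
  have hTT' : T * Tᵀ = 1 := (mul_eq_one_comm_of_card_eq _ _ _ (by
    rw [Fintype.card_sum, Fintype.card_fin, Fintype.card_fin, Fintype.card_fin]; omega)).1 hTT
  have hcol : ∀ b, (fun i => T i (Sum.inr b)) = (b₂ b : EuclideanSpace ℝ (Fin n)).ofLp :=
    fun b => rfl
  have h12' : (Tᵀ * A * T).toBlocks₁₂ = 0 := by
    ext a b
    rw [Matrix.mul_assoc]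
    change (b₁ a : EuclideanSpace ℝ (Fin n)).ofLp ⬝ᵥ
      (A *ᵥ (b₂ b : EuclideanSpace ℝ (Fin n)).ofLp) = 0
    exact h12 a (WithLp.toLp 2 (A *ᵥ (b₂ b : EuclideanSpace ℝ (Fin n)).ofLp))
      (mulVec_mem_undetectableSubspace (hb₂ b))
  have hC2 : (C * T).toCols₂ = 0 := by
    ext a b
    exact congrFun (mulVec_eq_zero_of_mem_undetectableSubspace (hb₂ b)) a
  refine ⟨⟨v, by rw [← hS]; omega, T, hTT, hTT', h12', hC2, ?_⟩⟩
  refine isDetectable_of_ker_eq (toRows₁_transpose_mul_of_toBlocks₁₂ hTT' h12')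
    (eq_toCols₁_mul_of_toCols₂ hTT' hC2) (toRows₁_transpose_mul_self hTT) fun x => ⟨fun hx => ?_,
    fun hx => ?_⟩
  · have h1 : x = T *ᵥ (Tᵀ *ᵥ x) := by rw [mulVec_mulVec, hTT', one_mulVec]
    have h2 : T *ᵥ (Tᵀ *ᵥ x) = ∑ b, (Tᵀ *ᵥ x) (Sum.inr b) •
        (b₂ b : EuclideanSpace ℝ (Fin n)).ofLp := by
      have h3 : ∀ a, (Tᵀ *ᵥ x) (Sum.inl a) = 0 := fun a => congrFun hx a
      ext i
      rw [mulVec, dotProduct, Fintype.sum_sum_type]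
      simp only [h3, mul_zero, Finset.sum_const_zero, zero_add, Finset.sum_apply, Pi.smul_apply,
        smul_eq_mul, ← hcol]
      exact Finset.sum_congr rfl fun b _ => mul_comm _ _
    rw [h1, h2]
    exact Submodule.sum_mem _ fun b _ => Submodule.smul_mem _ _ (hb₂ b)
  · ext a
    exact h12 a (WithLp.toLp 2 x) hx

end DetectabilityDecomposition

/-! ### The strict Riccati inequality by convex separation. -/

namespace Matrix

variable {ι : Type*} [Fintype ι]

/-- The matrices with positive quadratic form. -/
def posForm (ι : Type*) [Fintype ι] : Set (Matrix ι ι ℝ) :=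
  {M | ∀ x, x ≠ 0 → 0 < x ⬝ᵥ M *ᵥ x}

theorem convex_posForm : Convex ℝ (posForm ι) := by
  refine convex_iff_forall_pos.2 fun M hM N hN a b ha hb _ x hx => ?_
  rw [add_mulVec, smul_mulVec, smul_mulVec, dotProduct_add, dotProduct_smul, dotProduct_smul]
  exact add_pos (smul_pos ha (hM x hx)) (smul_pos hb (hN x hx))

theorem isOpen_posForm : IsOpen (posForm ι) := by
  rw [isOpen_iff_mem_nhds]
  intro M hM
  obtain ⟨c, hc, hcM⟩ := exists_coercive hM
  have hcont : Continuous fun N : Matrix ι ι ℝ => ∑ i, ∑ j, |(N - M) i j| := by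
    simp only [sub_apply]
    fun_prop
  have hnhds : {N : Matrix ι ι ℝ | ∑ i, ∑ j, |(N - M) i j| < c} ∈ nhds M :=
    (isOpen_lt hcont continuous_const).mem_nhds (by simpa using hc)
  refine Filter.mem_of_superset hnhds fun N hN x hx => ?_
  have h1 := neg_le_of_abs_le (abs_dotProduct_mulVec_le (N - M) x)
  have h2 := hcM x
  have h3 : 0 < x ⬝ᵥ x := (dotProduct_self_nonneg_real x).lt_of_ne fun h =>
    hx (dotProduct_self_eq_zero.1 h.symm)
  have h4 : (∑ i, ∑ j, |(N - M) i j|) * (x ⬝ᵥ x) < c * (x ⬝ᵥ x) :=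
    mul_lt_mul_of_pos_right hN h3
  rw [sub_mulVec, dotProduct_sub] at h1
  linarith

variable [DecidableEq ι]

/-- The range of a symmetric matrix is the orthogonal complement of its kernel. -/
theorem exists_mulVec_eq_of_orthogonal_ker {W : Matrix ι ι ℝ} (hs : Wᵀ = W) {y : ι → ℝ}
    (hy : ∀ x, W *ᵥ x = 0 → x ⬝ᵥ y = 0) : ∃ b, W *ᵥ b = y := by
  have hsym : LinearMap.IsSymmetric (toEuclideanLin W) := by
    rw [isSymmetric_toEuclideanLin_iff, IsHermitian, conjTranspose_eq_transpose_of_trivial, hs]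
  have h1 : WithLp.toLp 2 y ∈ (LinearMap.range (toEuclideanLin W))ᗮᗮ := by
    rw [hsym.orthogonal_range, Submodule.mem_orthogonal]
    intro x hx
    have := hy x.ofLp (congrArg WithLp.ofLp (LinearMap.mem_ker.1 hx))
    rw [EuclideanSpace.inner_eq_star_dotProduct, star_trivial, dotProduct_comm]
    exact this
  rw [Submodule.orthogonal_orthogonal] at h1
  obtain ⟨b, hb⟩ := h1
  exact ⟨b.ofLp, congrArg WithLp.ofLp hb⟩

/-- The form of AW + WAᵀ is nonnegative and vanishes on ker W, so Aᵀ preserves ker W. Taking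
orthogonal complements, A preserves the range of W. -/
theorem exists_mul_eq_mul_of_dotProduct_nonneg {W A : Matrix ι ι ℝ} (hs : Wᵀ = W)
    (hA : ∀ x, 0 ≤ x ⬝ᵥ A *ᵥ (W *ᵥ x)) : ∃ B : Matrix ι ι ℝ, W * B = A * W := by
  have hker : ∀ x, W *ᵥ x = 0 → W *ᵥ (Aᵀ *ᵥ x) = 0 := by
    intro x hx
    -- the form of `A W + W Aᵀ` is nonnegative and vanishes at `x`
    set V := A * W + W * Aᵀ with hV
    have hVs : Vᵀ = V := by
      rw [hV, transpose_add, transpose_mul, transpose_mul, transpose_transpose, hs, add_comm]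
    have hVf : ∀ z, z ⬝ᵥ V *ᵥ z = 2 * (z ⬝ᵥ A *ᵥ (W *ᵥ z)) := fun z => by
      have h1 : z ⬝ᵥ (W * Aᵀ) *ᵥ z = z ⬝ᵥ (A * W) *ᵥ z := by
        rw [← dotProduct_transpose_mulVec (A * W), transpose_mul, hs]
      rw [hV, add_mulVec, dotProduct_add, h1, ← mulVec_mulVec]
      ring
    have h2 := mulVec_eq_zero_of_dotProduct_eq_zero hVs
      (fun z => by rw [hVf]; linarith [hA z]) (x := x) (by rw [hVf, hx]; simp)
    rw [hV, add_mulVec, ← mulVec_mulVec, hx, mulVec_zero, zero_add, ← mulVec_mulVec] at h2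
    exact h2
  have hcol : ∀ j, ∃ b, W *ᵥ b = A *ᵥ (W *ᵥ Pi.single j 1) := fun j =>
    exists_mulVec_eq_of_orthogonal_ker hs fun x hx => by
      rw [← dotProduct_transpose_mulVec, dotProduct_mulVec_transpose_comm, hs, hker x hx,
        dotProduct_zero]
  choose b hb using hcol
  refine ⟨Matrix.of fun i j => b j i, ?_⟩
  ext i j
  have := congrFun (hb j) i
  rw [mulVec_mulVec, mulVec_single_one] at this
  exact this

/-- On the range of W the matrix A has no modes in the open left half-plane: AW + WAᵀ ≥ 0 acts as a
reversed Lyapunov inequality. The argument stays real by completing the square in the quadratic with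
roots z and its conjugate. -/
theorem mulVec_eq_zero_of_stable_factor {W A B : Matrix ι ι ℝ} (hs : Wᵀ = W)
    (hW : ∀ x, 0 ≤ x ⬝ᵥ W *ᵥ x) (hA : ∀ x, 0 ≤ x ⬝ᵥ A *ᵥ (W *ᵥ x)) (hB : W * B = A * W)
    {f : ℝ[X]} (hf : Irreducible f) {z : ℂ} (hz : aeval z f = 0) (hre : z.re < 0) {a : ι → ℝ}
    (ha : aeval A f *ᵥ (W *ᵥ a) = 0) : W *ᵥ a = 0 := by
  have hdvd : f ∣ (X - C z.re) ^ 2 + C (z.im ^ 2) := by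
    have h1 : f ∣ minpoly ℝ z := ⟨_, (minpoly.eq_of_irreducible hf hz).symm⟩
    refine h1.trans (minpoly.dvd ℝ z ?_)
    have h2 : z - (z.re : ℂ) = z.im * Complex.I := by
      apply Complex.ext <;> simp
    simp only [map_add, map_pow, map_sub, aeval_X, aeval_C, Complex.coe_algebraMap, h2,
      mul_pow, Complex.I_sq]
    ring
  obtain ⟨g, hg⟩ := hdvd
  have hq : (aeval A ((X - C z.re) ^ 2 + C (z.im ^ 2))) *ᵥ (W *ᵥ a) = 0 := by
    rw [hg, mul_comm, map_mul, ← mulVec_mulVec, ha, mulVec_zero]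
  set d : ι → ℝ := B *ᵥ a - z.re • a with hd
  have hBW : ∀ x, A *ᵥ (W *ᵥ x) = W *ᵥ (B *ᵥ x) := fun x => by
    rw [mulVec_mulVec, mulVec_mulVec, hB]
  have hd1 : W *ᵥ d = A *ᵥ (W *ᵥ a) - z.re • (W *ᵥ a) := by
    rw [hd, mulVec_sub, mulVec_smul, hBW]
  have hd2 : A *ᵥ (W *ᵥ d) - z.re • (W *ᵥ d) = -(z.im ^ 2 • (W *ᵥ a)) := by
    rw [eq_neg_iff_add_eq_zero, ← hq]
    simp only [map_add, map_mul, map_sub, aeval_X, aeval_C, Algebra.algebraMap_eq_smul_one, sq,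
      add_mulVec, ← mulVec_mulVec, sub_mulVec, smul_mulVec, one_mulVec, hd1, mulVec_sub,
      mulVec_smul, mul_smul]
  have hsymm : d ⬝ᵥ W *ᵥ a = a ⬝ᵥ W *ᵥ d := by
    rw [← dotProduct_transpose_mulVec, hs]
  have e1 : a ⬝ᵥ W *ᵥ d = a ⬝ᵥ A *ᵥ (W *ᵥ a) - z.re * (a ⬝ᵥ W *ᵥ a) := by
    rw [hd1, dotProduct_sub, dotProduct_smul, smul_eq_mul]
  have e2 : d ⬝ᵥ A *ᵥ (W *ᵥ d) - z.re * (d ⬝ᵥ W *ᵥ d) = -(z.im ^ 2 * (a ⬝ᵥ W *ᵥ d)) := by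
    have := congrArg (fun v => d ⬝ᵥ v) hd2
    simpa only [dotProduct_sub, dotProduct_smul, smul_eq_mul, dotProduct_neg, hsymm] using this
  have p1 := hA a
  have p2 := hA d
  have p3 := hW a
  have p4 := hW d
  have p5 : 0 ≤ a ⬝ᵥ W *ᵥ d := by rw [e1]; nlinarith
  have p6 : 0 ≤ z.im ^ 2 * (a ⬝ᵥ W *ᵥ d) := by positivity
  have p7 : d ⬝ᵥ W *ᵥ d = 0 := by
    by_contra hne
    -- In `e2` the left side is a sum of nonnegative terms, since Re z < 0, while the right side is
    -- nonpositive.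
    have : 0 < d ⬝ᵥ W *ᵥ d := lt_of_le_of_ne p4 (Ne.symm hne)
    nlinarith
  have p8 := mulVec_eq_zero_of_dotProduct_eq_zero hs hW p7
  rw [p8, dotProduct_zero] at e1
  refine mulVec_eq_zero_of_dotProduct_eq_zero hs hW ?_
  by_contra hne
  have : 0 < a ⬝ᵥ W *ᵥ a := lt_of_le_of_ne p3 (Ne.symm hne)
  nlinarith

variable {μ : Type*}

/-- A detectable pair admits no nonzero `W ≥ 0` with `A W + W Aᵀ ≥ 0` and `C W = 0`. -/
theorem eq_zero_of_isDetectable {W A : Matrix ι ι ℝ} {C : Matrix μ ι ℝ} (hd : IsDetectable C A)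
    (hs : Wᵀ = W) (hW : ∀ x, 0 ≤ x ⬝ᵥ W *ᵥ x) (hA : ∀ x, 0 ≤ x ⬝ᵥ A *ᵥ (W *ᵥ x))
    (hC : C * W = 0) : W = 0 := by
  obtain ⟨B, hB⟩ := exists_mul_eq_mul_of_dotProduct_nonneg hs hA
  have hinv : ∀ (f : ℝ[X]) (x : ι → ℝ), aeval A f *ᵥ (W *ᵥ x) = W *ᵥ (aeval B f *ᵥ x) :=
    fun f x => by rw [mulVec_mulVec, mulVec_mulVec, aeval_intertwine hB]
  have hprod : ∀ s : Multiset ℝ[X],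
      (∀ f ∈ s, Irreducible f ∧ ∃ z : ℂ, aeval z f = 0 ∧ z.re < 0) → ∀ a : ι → ℝ,
      aeval A s.prod *ᵥ (W *ᵥ a) = 0 → W *ᵥ a = 0 := by
    intro s
    induction s using Multiset.induction with
    | empty => intro _ a ha; simpa using ha
    | cons f s ih =>
      intro hs' a ha
      obtain ⟨hf, z, hz, hre⟩ := hs' f (Multiset.mem_cons_self f s)
      rw [Multiset.prod_cons, map_mul, ← mulVec_mulVec, hinv] at ha
      refine ih (fun g hg => hs' g (Multiset.mem_cons_of_mem hg)) a ?_
      rw [hinv]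
      exact mulVec_eq_zero_of_stable_factor hs hW hA hB hf hz hre ha
  obtain ⟨s, hs', hA0⟩ := exists_stable_factors A
  have h0 : ∀ a, W *ᵥ a = 0 := by
    intro a
    refine isDetectable_iff.1 hd _ (fun k => ?_) ?_
    · rw [mulVec_mulVec _ (A ^ k), ← pow_intertwine hB, ← mulVec_mulVec, mulVec_mulVec, hC,
        zero_mulVec]
    · rw [hinv]
      refine hprod s hs' _ ?_
      rw [← hinv, mulVec_mulVec, ← map_mul, hA0, zero_mulVec]
  ext i j
  have := congrFun (h0 (Pi.single j 1)) i
  rwa [mulVec_single_one] at this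

/-- A pair of matrix linear forms `g₁`, `g₂` that are nonnegative on dyads `x xᵀ` and satisfy
`g₁ X = g₂ (Aᵀ X + X A)` and `g₂ (Cᵀ C) = 0` vanishes on dyads if `(C, A)` is detectable. -/
theorem forms_vecMulVec_eq_zero_of_isDetectable [Fintype μ] {A : Matrix ι ι ℝ} {C : Matrix μ ι ℝ}
    (hd : IsDetectable C A) {g₁ g₂ : Matrix ι ι ℝ →ₗ[ℝ] ℝ}
    (h₁ : ∀ x, 0 ≤ g₁ (vecMulVec x x)) (h₂ : ∀ x, 0 ≤ g₂ (vecMulVec x x))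
    (h₁₂ : ∀ X, g₁ X = g₂ (Aᵀ * X + X * A)) (hC : g₂ (Cᵀ * C) = 0) (x : ι → ℝ) :
    g₁ (vecMulVec x x) = 0 ∧ g₂ (vecMulVec x x) = 0 := by
  let b : (ι → ℝ) →ₗ[ℝ] (ι → ℝ) →ₗ[ℝ] ℝ := LinearMap.mk₂ ℝ
    (fun x y => g₂ (vecMulVec x y + vecMulVec y x))
    (fun x y z => by rw [← map_add, add_vecMulVec, vecMulVec_add]; congr 1; abel)
    (fun c x y => by rw [← map_smul, smul_vecMulVec, vecMulVec_smul, smul_add])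
    (fun x y z => by rw [← map_add, add_vecMulVec, vecMulVec_add]; congr 1; abel)
    (fun c x y => by rw [← map_smul, smul_vecMulVec, vecMulVec_smul, smul_add])
  have hb : ∀ x y, b x y = g₂ (vecMulVec x y + vecMulVec y x) := fun x y => rfl
  -- `W` represents `g₂` on symmetrized dyads. In terms of it the hypotheses say W ≥ 0, AW + WAᵀ ≥ 0
  -- and CW = 0.
  set W : Matrix ι ι ℝ := LinearMap.toMatrix₂' ℝ b with hWdef
  have hW : ∀ x y, x ⬝ᵥ W *ᵥ y = g₂ (vecMulVec x y + vecMulVec y x) := fun x y => by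
    rw [← Matrix.toLinearMap₂'_apply', hWdef, Matrix.toLinearMap₂'_toMatrix', hb]
  have hWx : ∀ x, x ⬝ᵥ W *ᵥ x = 2 * g₂ (vecMulVec x x) := fun x => by
    rw [hW, map_add, two_mul]
  have hs : Wᵀ = W := by
    ext i j
    rw [transpose_apply, hWdef, LinearMap.toMatrix₂'_apply, LinearMap.toMatrix₂'_apply, hb, hb,
      add_comm]
  have hnn : ∀ x, 0 ≤ x ⬝ᵥ W *ᵥ x := fun x => by
    rw [hWx]
    linarith [h₂ x]
  have hA : ∀ x, x ⬝ᵥ A *ᵥ (W *ᵥ x) = g₁ (vecMulVec x x) := fun x => by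
    rw [← dotProduct_transpose_mulVec, dotProduct_comm, hW, h₁₂, mul_vecMulVec, vecMulVec_mul,
      mulVec_transpose]
  have hCW : C * W = 0 := by
    have hsum : Cᵀ * C = ∑ k, vecMulVec (C.row k) (C.row k) := by
      ext i j
      simp [mul_apply, sum_apply, vecMulVec_apply]
    rw [hsum, map_sum, Finset.sum_eq_zero_iff_of_nonneg fun k _ => h₂ _] at hC
    ext k j
    have h := mulVec_eq_zero_of_dotProduct_eq_zero hs hnn (x := C.row k)
      (by rw [hWx, hC k (Finset.mem_univ k), mul_zero])
    rw [← hs, mulVec_transpose] at h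
    exact congrFun h j
  have h0 := eq_zero_of_isDetectable hd hs hnn (fun x => by rw [hA]; exact h₁ x) hCW
  have h1 := hA x
  have h2 := hWx x
  rw [h0] at h1 h2
  simp only [zero_mulVec, mulVec_zero, dotProduct_zero] at h1 h2
  exact ⟨h1.symm, by linarith⟩

/-- A linear functional that is bounded below on a subspace vanishes there. -/
theorem exists_form_neg_of_disjoint {E : Type*} [AddCommGroup E] [Module ℝ E] [TopologicalSpace E]
    [IsTopologicalAddGroup E] [ContinuousSMul ℝ E] {s : Set E} (hs : Convex ℝ s) (hso : IsOpen s)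
    (t : Submodule ℝ E) (hst : Disjoint s (t : Set E)) :
    ∃ f : E →ₗ[ℝ] ℝ, (∀ a ∈ s, f a < 0) ∧ ∀ b ∈ t, f b = 0 := by
  obtain ⟨f, u, hfs, hft⟩ := geometric_hahn_banach_open hs hso t.convex hst
  have hu : u ≤ 0 := by
    have := hft 0 t.zero_mem
    rwa [map_zero] at this
  refine ⟨f, fun a ha => (hfs a ha).trans_le hu, fun b hb => ?_⟩
  by_contra hne
  change f b ≠ 0 at hne
  have := hft (((u - 1) / f b) • b) (t.smul_mem _ hb)
  rw [map_smul, smul_eq_mul, div_mul_cancel₀ _ hne] at this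
  linarith

theorem exists_form_neg_of_range_disjoint {κ F : Type*} [Fintype κ] [AddCommGroup F] [Module ℝ F]
    (Ψ : F →ₗ[ℝ] Matrix κ κ ℝ × Matrix κ κ ℝ) (h : ∀ x, Ψ x ∉ posForm κ ×ˢ posForm κ) :
    ∃ f : Matrix κ κ ℝ × Matrix κ κ ℝ →ₗ[ℝ] ℝ,
      (∀ a ∈ posForm κ ×ˢ posForm κ, f a < 0) ∧ ∀ x, f (Ψ x) = 0 := by
  have hc : Convex ℝ (posForm κ ×ˢ posForm κ) := convex_posForm.prod convex_posForm
  have ho : IsOpen (posForm κ ×ˢ posForm κ) := isOpen_posForm.prod isOpen_posForm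
  have hd : Disjoint (posForm κ ×ˢ posForm κ)
      (LinearMap.range Ψ : Set (Matrix κ κ ℝ × Matrix κ κ ℝ)) := by
    rw [Set.disjoint_left]
    rintro _ h1 ⟨x, rfl⟩
    exact h x h1
  obtain ⟨f, h1, h2⟩ := exists_form_neg_of_disjoint hc ho (LinearMap.range Ψ) hd
  exact ⟨f, h1, fun x => h2 _ ⟨x, rfl⟩⟩

theorem one_mem_posForm : (1 : Matrix ι ι ℝ) ∈ posForm ι := fun x hx => by
  rw [one_mulVec]
  exact (dotProduct_self_nonneg_real x).lt_of_ne fun h => hx (dotProduct_self_eq_zero.1 h.symm)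

/-- Adding δ(1, 1) moves a semidefinite pair into the open cone; small δ gives the claim in the
limit. -/
theorem form_nonpos_of_neg {f : Matrix ι ι ℝ × Matrix ι ι ℝ →ₗ[ℝ] ℝ}
    (hfs : ∀ p ∈ posForm ι ×ˢ posForm ι, f p < 0) {X Y : Matrix ι ι ℝ}
    (hX : ∀ x, 0 ≤ x ⬝ᵥ X *ᵥ x) (hY : ∀ x, 0 ≤ x ⬝ᵥ Y *ᵥ x) : f (X, Y) ≤ 0 := by
  have h1 : f (1, 1) < 0 := (hfs (1, 1) ⟨one_mem_posForm, one_mem_posForm⟩)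
  have hδ : ∀ δ : ℝ, 0 < δ → f (X, Y) + δ * f (1, 1) < 0 := by
    intro δ hδ
    have hmem : ∀ Z : Matrix ι ι ℝ, (∀ x, 0 ≤ x ⬝ᵥ Z *ᵥ x) → Z + δ • 1 ∈ posForm ι :=
      fun Z hZ x hx => by
        rw [add_mulVec, smul_mulVec, dotProduct_add, dotProduct_smul]
        exact add_pos_of_nonneg_of_pos (hZ x) (smul_pos hδ (one_mem_posForm x hx))
    have := (hfs (X + δ • 1, Y + δ • 1) ⟨hmem X hX, hmem Y hY⟩)
    rwa [← Prod.mk_add_mk, ← Prod.smul_mk, map_add, map_smul, smul_eq_mul] at this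
  by_contra! hpos
  have := hδ (f (X, Y) / (-(2 * f (1, 1)))) (div_pos hpos (by linarith))
  have h3 : f (X, Y) / (-(2 * f (1, 1))) * f (1, 1) = -(f (X, Y) / 2) := by
    have h4 := h1.ne
    field_simp
  linarith

/-- Detectability yields a strict solution of the dual Lyapunov inequality, up to symmetrization
and scaling. -/
theorem exists_posForm_of_isDetectable [Fintype μ] {A : Matrix ι ι ℝ} {C : Matrix μ ι ℝ}
    (hd : IsDetectable C A) : ∃ (X : Matrix ι ι ℝ) (m : ℝ), X ∈ posForm ι ∧
      m • (Cᵀ * C) - (Aᵀ * X + X * A) ∈ posForm ι := by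
  by_contra! hno
  -- Both conditions are linear in (X, m), so failure means that the range of `Ψ` misses an open
  -- convex cone. X need not be symmetric, which keeps the cone open in the full matrix space.
  obtain ⟨Ψ, hΨ⟩ : ∃ Ψ : Matrix ι ι ℝ × ℝ →ₗ[ℝ] Matrix ι ι ℝ × Matrix ι ι ℝ,
      ∀ X m, Ψ (X, m) = (X, m • (Cᵀ * C) - (Aᵀ * X + X * A)) :=
    ⟨{  toFun := fun p => (p.1, p.2 • (Cᵀ * C) - (Aᵀ * p.1 + p.1 * A))
        map_add' := fun p q => Prod.ext rfl (by
          simp only [Prod.fst_add, Prod.snd_add, Matrix.mul_add, Matrix.add_mul, add_smul]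
          abel)
        map_smul' := fun c p => Prod.ext rfl (by
          simp only [Prod.smul_fst, Prod.smul_snd, Matrix.mul_smul, Matrix.smul_mul, smul_sub,
            smul_add, smul_assoc, RingHom.id_apply]) }, fun _ _ => rfl⟩
  obtain ⟨f, hfs, hf0⟩ := exists_form_neg_of_range_disjoint Ψ (by
    rintro ⟨X, m⟩ h
    rw [hΨ] at h
    exact hno X m h.1 h.2)
  obtain ⟨g₁, hg₁⟩ : ∃ g : Matrix ι ι ℝ →ₗ[ℝ] ℝ, ∀ X, g X = -f (X, 0) :=
    ⟨-(f ∘ₗ LinearMap.inl ℝ _ _), fun _ => rfl⟩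
  obtain ⟨g₂, hg₂⟩ : ∃ g : Matrix ι ι ℝ →ₗ[ℝ] ℝ, ∀ X, g X = -f (0, X) :=
    ⟨-(f ∘ₗ LinearMap.inr ℝ _ _), fun _ => rfl⟩
  have hdyad : ∀ x y : ι → ℝ, 0 ≤ y ⬝ᵥ vecMulVec x x *ᵥ y := fun x y => by
    rw [vecMulVec_mulVec, dotProduct_smul, dotProduct_comm x y, MulOpposite.smul_eq_mul_unop]
    exact mul_self_nonneg _
  have hzero : ∀ y : ι → ℝ, 0 ≤ y ⬝ᵥ (0 : Matrix ι ι ℝ) *ᵥ y := fun y => by simp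
  have hsplit : ∀ X Y, f (X, Y) = -g₁ X - g₂ Y := fun X Y => by
    rw [hg₁, hg₂, show ((X, Y) : Matrix ι ι ℝ × Matrix ι ι ℝ) = (X, 0) + (0, Y) by simp, map_add]
    ring
  have hrel := fun X m => hf0 (X, m)
  simp only [hΨ, hsplit] at hrel
  have hfin := forms_vecMulVec_eq_zero_of_isDetectable hd (g₁ := g₁) (g₂ := g₂)
    (fun x => by rw [hg₁]; linarith [form_nonpos_of_neg hfs (hdyad x) hzero])
    (fun x => by rw [hg₂]; linarith [form_nonpos_of_neg hfs hzero (hdyad x)])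
    (fun X => by
      have := hrel X 0
      rw [zero_smul, zero_sub, map_neg] at this
      linarith)
    (by
      have := hrel 0 1
      simpa using this)
  have h1 : f (1, 1) < 0 := (hfs (1, 1) ⟨one_mem_posForm, one_mem_posForm⟩)
  have hsum : (1 : Matrix ι ι ℝ) = ∑ i, vecMulVec (Pi.single i 1) (Pi.single i 1) := by
    ext i j
    simp [sum_apply, vecMulVec_apply, one_apply, Pi.single_apply]
  rw [hsplit, hsum, map_sum, map_sum, Finset.sum_eq_zero fun i _ => (hfin _).1,
    Finset.sum_eq_zero fun i _ => (hfin _).2] at h1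
  simp at h1

/-- A detectable pair has a positive definite solution of the strict Riccati inequality. -/
theorem exists_riccati_of_isDetectable [Fintype μ] {A : Matrix ι ι ℝ} {C : Matrix μ ι ℝ}
    (hd : IsDetectable C A) : ∃ Q : Matrix ι ι ℝ, Q.PosDef ∧
      (-(A * Q + Q * Aᵀ - Q * Cᵀ * C * Q)).PosDef := by
  obtain ⟨X, m, hX, hF⟩ := exists_posForm_of_isDetectable hd
  -- This makes c positive with cm ≤ 1, so after scaling by c the coefficient of CᵀC may be replaced
  -- by 1.
  set c : ℝ := (max m 1)⁻¹ with hc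
  have hm0 : 0 < max m 1 := lt_max_of_lt_right one_pos
  have hc0 : 0 < c := inv_pos.2 hm0
  set Y : Matrix ι ι ℝ := (c / 2) • (X + Xᵀ) with hY
  have hYf : ∀ x, x ⬝ᵥ Y *ᵥ x = c * (x ⬝ᵥ X *ᵥ x) := fun x => by
    rw [hY, smul_mulVec, dotProduct_smul, add_mulVec, dotProduct_add,
      dotProduct_transpose_mulVec, smul_eq_mul]
    ring
  have hYp : Y.PosDef := by
    refine posDef_real_iff.2 ⟨?_, fun x hx => ?_⟩
    · rw [hY, transpose_smul, transpose_add, transpose_transpose, add_comm]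
    · rw [hYf]
      exact mul_pos hc0 (hX x hx)
  have hYs : Yᵀ = Y := (posDef_real_iff.1 hYp).1
  set F : Matrix ι ι ℝ := Cᵀ * C - (Aᵀ * Y + Y * A) with hFdef
  have hFp : ∀ x, x ≠ 0 → 0 < x ⬝ᵥ F *ᵥ x := fun x hx => by
    have h1 := hF x hx
    have hCC : 0 ≤ x ⬝ᵥ (Cᵀ * C) *ᵥ x := by
      rw [← mulVec_mulVec, ← dotProduct_mulVec_transpose_comm]
      exact dotProduct_self_nonneg_real _
    have h2 : x ⬝ᵥ (Aᵀ * Y + Y * A) *ᵥ x = c * (x ⬝ᵥ (Aᵀ * X + X * A) *ᵥ x) := by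
      rw [← lyapunov_dotProduct, ← lyapunov_dotProduct, hY]
      simp only [smul_mulVec, dotProduct_smul, add_mulVec, dotProduct_add,
        dotProduct_transpose_mulVec, smul_eq_mul]
      ring
    rw [sub_mulVec, dotProduct_sub, smul_mulVec, dotProduct_smul, smul_eq_mul] at h1
    rw [hFdef, sub_mulVec, dotProduct_sub, h2]
    have h3 : c * (m * (x ⬝ᵥ (Cᵀ * C) *ᵥ x)) ≤ x ⬝ᵥ (Cᵀ * C) *ᵥ x := by
      have : c * m ≤ 1 := by
        rw [hc, inv_mul_le_one₀ hm0]
        exact le_max_left _ _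
      nlinarith
    have h4 := mul_pos hc0 h1
    linarith
  have hFs : Fᵀ = F := by
    rw [hFdef, transpose_sub, transpose_add, transpose_mul, transpose_mul, transpose_mul,
      transpose_transpose, transpose_transpose, hYs, add_comm]
  have hdet : IsUnit Y.det := (isUnit_iff_isUnit_det Y).1 hYp.isUnit
  have hQs : Y⁻¹ᵀ = Y⁻¹ := by rw [transpose_nonsing_inv, hYs]
  refine ⟨Y⁻¹, hYp.inv, ?_⟩
  -- Congruence with Q = Y⁻¹ turns the dual Lyapunov inequality, linear in Y, into the Riccati
  -- inequality.
  have hid : -(A * Y⁻¹ + Y⁻¹ * Aᵀ - Y⁻¹ * Cᵀ * C * Y⁻¹) = Y⁻¹ᵀ * F * Y⁻¹ := by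
    rw [hQs, hFdef, Matrix.mul_sub, Matrix.sub_mul, Matrix.mul_add, Matrix.add_mul,
      ← Matrix.mul_assoc Y⁻¹ Y A, nonsing_inv_mul Y hdet, Matrix.one_mul,
      ← Matrix.mul_assoc Y⁻¹ Aᵀ Y, Matrix.mul_assoc (Y⁻¹ * Aᵀ) Y, mul_nonsing_inv Y hdet,
      Matrix.mul_one, ← Matrix.mul_assoc Y⁻¹ Cᵀ C]
    abel
  rw [hid]
  refine posDef_real_iff.2 ⟨?_, fun x hx => ?_⟩
  · rw [transpose_mul, transpose_mul, transpose_transpose, hFs, Matrix.mul_assoc]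
  · rw [← mulVec_mulVec, ← mulVec_mulVec, ← dotProduct_mulVec_transpose_comm]
    refine hFp _ fun h0 => hx ?_
    have := congrArg (fun v => Y *ᵥ v) h0
    simpa [mulVec_mulVec, mul_nonsing_inv Y hdet] using this

end Matrix

/-! ### One local filter: gains, storage matrix and dissipation. -/

namespace Matrix

variable {ι α β μ : Type*} [Fintype ι] [Fintype α] [Fintype β]

theorem eq_toCols_mul_toRows [DecidableEq ι] {T : Matrix ι (α ⊕ β) ℝ} (hT : T * Tᵀ = 1)
    (M : Matrix μ ι ℝ) :
    M = (M * T).toCols₁ * Tᵀ.toRows₁ + (M * T).toCols₂ * Tᵀ.toRows₂ := by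
  rw [← fromCols_mul_fromRows, fromCols_toCols, fromRows_toRows, Matrix.mul_assoc, hT,
    Matrix.mul_one]

/-- Lyapunov's inequality for `K` in terms of the inverse of a solution of the dual one. -/
theorem lyapunov_inv_neg [DecidableEq ι] {K Q : Matrix ι ι ℝ} (hQ : Q.PosDef)
    (hK : ∀ x, x ≠ 0 → x ⬝ᵥ (K * Q + Q * Kᵀ) *ᵥ x < 0) {x : ι → ℝ} (hx : x ≠ 0) :
    x ⬝ᵥ (Kᵀ * Q⁻¹ + Q⁻¹ * K) *ᵥ x < 0 := by
  have hdet : IsUnit Q.det := (isUnit_iff_isUnit_det Q).1 hQ.isUnit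
  have hQs : Q⁻¹ᵀ = Q⁻¹ := by rw [transpose_nonsing_inv, (posDef_real_iff.1 hQ).1]
  have hid : Kᵀ * Q⁻¹ + Q⁻¹ * K = Q⁻¹ᵀ * (K * Q + Q * Kᵀ) * Q⁻¹ := by
    rw [hQs, Matrix.mul_add, Matrix.add_mul, ← Matrix.mul_assoc Q⁻¹ K Q,
      Matrix.mul_assoc (Q⁻¹ * K) Q, mul_nonsing_inv Q hdet, Matrix.mul_one,
      ← Matrix.mul_assoc Q⁻¹ Q, nonsing_inv_mul Q hdet, Matrix.one_mul, add_comm]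
  rw [hid, ← mulVec_mulVec, ← mulVec_mulVec, ← dotProduct_mulVec_transpose_comm]
  refine hK _ fun h0 => hx ?_
  have := congrArg (fun v => Q *ᵥ v) h0
  simpa [mulVec_mulVec, mul_nonsing_inv Q hdet] using this

theorem dotProduct_transpose_mul_self_mulVec [Fintype μ] (C : Matrix μ ι ℝ) (x : ι → ℝ) :
    x ⬝ᵥ (Cᵀ * C) *ᵥ x = (C *ᵥ x) ⬝ᵥ (C *ᵥ x) := by
  rw [← mulVec_mulVec, ← dotProduct_mulVec_transpose_comm]

theorem two_mul_dotProduct_mulVec_le (B : Matrix α β ℝ) (x : β → ℝ) (y : α → ℝ) {c : ℝ}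
    (hc : 0 < c) :
    2 * (y ⬝ᵥ B *ᵥ x) ≤ c * (x ⬝ᵥ x) + 1 / c * ((Bᵀ *ᵥ y) ⬝ᵥ (Bᵀ *ᵥ y)) := by
  rw [← dotProduct_transpose_mulVec]
  have h1 := dotProduct_self_nonneg_real (c • x - Bᵀ *ᵥ y)
  simp only [sub_dotProduct, dotProduct_sub, smul_dotProduct, dotProduct_smul, smul_eq_mul,
    dotProduct_comm (Bᵀ *ᵥ y) x] at h1
  have h2 : 2 * (x ⬝ᵥ Bᵀ *ᵥ y) * c
      ≤ (c * (x ⬝ᵥ x) + 1 / c * ((Bᵀ *ᵥ y) ⬝ᵥ (Bᵀ *ᵥ y))) * c := by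
    have h3 : 1 / c * ((Bᵀ *ᵥ y) ⬝ᵥ (Bᵀ *ᵥ y)) * c = (Bᵀ *ᵥ y) ⬝ᵥ (Bᵀ *ᵥ y) := by field_simp
    rw [add_mul, h3]
    linarith
  exact le_of_mul_le_mul_right h2 hc

theorem dotProduct_le_of_posDef_neg [DecidableEq ι] [Fintype μ] {A : Matrix ι ι ℝ}
    {B : Matrix ι α ℝ} {H : Matrix μ ι ℝ} {c : ℝ}
    (h : (-(A + Aᵀ + Hᵀ * H - c • (1 : Matrix ι ι ℝ) + (1 / c) • (B * Bᵀ))).PosDef) (y : ι → ℝ) :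
    2 * (y ⬝ᵥ A *ᵥ y) + (H *ᵥ y) ⬝ᵥ (H *ᵥ y) + 1 / c * ((Bᵀ *ᵥ y) ⬝ᵥ (Bᵀ *ᵥ y))
      ≤ c * (y ⬝ᵥ y) := by
  have h1 := h.posSemidef.dotProduct_mulVec_nonneg y
  rw [star_trivial] at h1
  have h2 : y ⬝ᵥ (B * Bᵀ) *ᵥ y = (Bᵀ *ᵥ y) ⬝ᵥ (Bᵀ *ᵥ y) := by
    rw [← dotProduct_transpose_mul_self_mulVec, transpose_transpose]
  have h3 := dotProduct_transpose_mulVec A y y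
  simp only [neg_mulVec, add_mulVec, sub_mulVec, smul_mulVec, one_mulVec, dotProduct_neg,
    dotProduct_add, dotProduct_sub, dotProduct_smul, smul_eq_mul, h2, h3,
    dotProduct_transpose_mul_self_mulVec] at h1
  linarith

theorem exists_forall_posDef_neg_sub_smul [DecidableEq ι] {S B : Matrix ι ι ℝ} (hS : Sᵀ = S)
    (hB : Bᵀ = B) {ε : ℝ} (hε : 0 < ε) : ∃ κ₀ : ℝ, 0 < κ₀ ∧ ∀ κ : ℝ, κ₀ ≤ κ →
      (-(S - (κ * ε) • (1 : Matrix ι ι ℝ) + (1 / (κ * ε)) • B)).PosDef := by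
  set s : ℝ := ∑ i, ∑ j, |S i j| with hs
  set b : ℝ := ∑ i, ∑ j, |B i j| with hb
  have hs0 : 0 ≤ s := Finset.sum_nonneg fun i _ => Finset.sum_nonneg fun j _ => abs_nonneg _
  have hb0 : 0 ≤ b := Finset.sum_nonneg fun i _ => Finset.sum_nonneg fun j _ => abs_nonneg _
  -- Then κε ≥ s + b + 1 ≥ 1, so 1/(κε) ≤ 1 and κε dominates both remaining forms strictly.
  refine ⟨(s + b + 1) / ε, by positivity, fun κ hκ => posDef_real_iff.2 ⟨?_, fun x hx => ?_⟩⟩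
  · rw [transpose_neg, transpose_add, transpose_sub, transpose_smul, transpose_smul,
      transpose_one, hS, hB]
  · rw [div_le_iff₀ hε] at hκ
    have h1 := (le_abs_self _).trans (abs_dotProduct_mulVec_le S x)
    have h2 := (le_abs_self _).trans (abs_dotProduct_mulVec_le B x)
    have h3 : 0 < x ⬝ᵥ x := (dotProduct_self_nonneg_real x).lt_of_ne fun h =>
      hx (dotProduct_self_eq_zero.1 h.symm)
    rw [← hs] at h1
    rw [← hb] at h2
    have h4 : 0 < κ * ε := by linarith
    have h5 : 1 / (κ * ε) ≤ 1 := by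
      rw [div_le_one h4]
      linarith
    have h6 : 1 / (κ * ε) * (x ⬝ᵥ B *ᵥ x) ≤ b * (x ⬝ᵥ x) := by
      have h7 : 0 ≤ b * (x ⬝ᵥ x) := by positivity
      have h8 : 0 < 1 / (κ * ε) := by positivity
      nlinarith
    have h9 : (s + b + 1) * (x ⬝ᵥ x) ≤ κ * ε * (x ⬝ᵥ x) := by gcongr
    simp only [neg_mulVec, add_mulVec, sub_mulVec, smul_mulVec, one_mulVec, dotProduct_neg,
      dotProduct_add, dotProduct_sub, dotProduct_smul, smul_eq_mul]
    linarith

end Matrix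

namespace DetectabilityDecomposition

variable {n s q p : ℕ} {C : Matrix (Fin s) (Fin n) ℝ} {A : Matrix (Fin n) (Fin n) ℝ}
  (d : DetectabilityDecomposition C A)

/-- The coordinates with respect to the first columns of `T`. -/
def proj₁ : Matrix (Fin d.v) (Fin n) ℝ := d.Tᵀ.toRows₁

/-- The coordinates with respect to the last columns of `T`. -/
def proj₂ : Matrix (Fin (n - d.v)) (Fin n) ℝ := d.Tᵀ.toRows₂

theorem T_eq : d.T = fromCols d.proj₁ᵀ d.proj₂ᵀ := by
  ext i c
  cases c <;> rfl

theorem transpose_T_eq : d.Tᵀ = fromRows d.proj₁ d.proj₂ := (fromRows_toRows _).symm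

theorem proj₁_mul_transpose : d.proj₁ * d.proj₁ᵀ = 1 :=
  toRows₁_transpose_mul_self d.transpose_mul_self

theorem proj₂_mul_transpose : d.proj₂ * d.proj₂ᵀ = 1 := by
  ext a b
  have := congrFun (congrFun d.transpose_mul_self (Sum.inr a)) (Sum.inr b)
  simpa [Matrix.mul_apply, Matrix.one_apply, proj₂] using this

theorem proj₂_mul_proj₁_transpose : d.proj₂ * d.proj₁ᵀ = 0 := by
  ext a b
  have := congrFun (congrFun d.transpose_mul_self (Sum.inr a)) (Sum.inl b)
  simpa [Matrix.mul_apply, Matrix.one_apply, proj₂, proj₁] using this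

theorem proj₁_mul_proj₂_transpose : d.proj₁ * d.proj₂ᵀ = 0 := by
  rw [← transpose_transpose d.proj₁, ← transpose_mul, proj₂_mul_proj₁_transpose, transpose_zero]

theorem transpose_mul_proj_add : d.proj₁ᵀ * d.proj₁ + d.proj₂ᵀ * d.proj₂ = 1 := by
  rw [← fromCols_mul_fromRows, ← T_eq, ← transpose_T_eq, d.mul_transpose_self]

theorem proj₁_mul_A : d.proj₁ * A = d.A₁₁ * d.proj₁ :=
  toRows₁_transpose_mul_of_toBlocks₁₂ d.mul_transpose_self d.toBlocks₁₂_eq_zero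

theorem proj₂_mul_A : d.proj₂ * A = d.A₂₁ * d.proj₁ + d.A₂₂ * d.proj₂ :=
  eq_toCols_mul_toRows d.mul_transpose_self (d.proj₂ * A)

theorem C_eq : C = d.C₁ * d.proj₁ :=
  eq_toCols₁_mul_of_toCols₂ d.mul_transpose_self d.toCols₂_eq_zero

theorem H_eq (H : Matrix (Fin p) (Fin n) ℝ) : H = d.H₁ H * d.proj₁ + d.H₂ H * d.proj₂ :=
  eq_toCols_mul_toRows d.mul_transpose_self H

theorem gainG_eq (Q : Matrix (Fin d.v) (Fin d.v) ℝ) : d.gainG Q = d.proj₁ᵀ * d.G₁ Q := by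
  have h : d.gainG Q
      = d.T * fromRows (d.G₁ Q) (0 : Matrix (Fin (n - d.v)) (Fin s) ℝ) := rfl
  rw [h, T_eq, fromCols_mul_fromRows, Matrix.mul_zero, add_zero]

/-- The matrix `T [P 0; 0 I] Tᵀ`. -/
def storage (P : Matrix (Fin d.v) (Fin d.v) ℝ) : Matrix (Fin n) (Fin n) ℝ :=
  d.proj₁ᵀ * P * d.proj₁ + d.proj₂ᵀ * d.proj₂

theorem gainF_eq (c : ℝ) (P : Matrix (Fin d.v) (Fin d.v) ℝ) :
    d.gainF c P = c • d.storage P⁻¹ := by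
  rw [gainF, transpose_T_eq, T_eq, fromCols_mul_fromBlocks, fromCols_mul_fromRows, storage]
  simp

theorem storage_mul_storage (P P' : Matrix (Fin d.v) (Fin d.v) ℝ) :
    d.storage P * d.storage P' = d.storage (P * P') := by
  simp only [storage, Matrix.mul_add, Matrix.add_mul]
  rw [show d.proj₁ᵀ * P * d.proj₁ * (d.proj₁ᵀ * P' * d.proj₁)
      = d.proj₁ᵀ * P * (d.proj₁ * d.proj₁ᵀ) * P' * d.proj₁ by simp only [Matrix.mul_assoc],
    show d.proj₂ᵀ * d.proj₂ * (d.proj₁ᵀ * P' * d.proj₁)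
      = d.proj₂ᵀ * (d.proj₂ * d.proj₁ᵀ) * P' * d.proj₁ by simp only [Matrix.mul_assoc],
    show d.proj₁ᵀ * P * d.proj₁ * (d.proj₂ᵀ * d.proj₂)
      = d.proj₁ᵀ * P * (d.proj₁ * d.proj₂ᵀ) * d.proj₂ by simp only [Matrix.mul_assoc],
    show d.proj₂ᵀ * d.proj₂ * (d.proj₂ᵀ * d.proj₂)
      = d.proj₂ᵀ * (d.proj₂ * d.proj₂ᵀ) * d.proj₂ by simp only [Matrix.mul_assoc],
    proj₁_mul_transpose, proj₂_mul_proj₁_transpose, proj₁_mul_proj₂_transpose,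
    proj₂_mul_transpose]
  simp [Matrix.mul_assoc]

/-- This cancellation motivates the form of F: in the storage derivative the coupling no longer
depends on P or T. -/
theorem storage_mul_gainF (c : ℝ) {P : Matrix (Fin d.v) (Fin d.v) ℝ} (hP : P.PosDef) :
    d.storage P * d.gainF c P = c • 1 := by
  have hdet : IsUnit P.det := (isUnit_iff_isUnit_det P).1 hP.isUnit
  rw [gainF_eq, Matrix.mul_smul, storage_mul_storage, mul_nonsing_inv P hdet, storage,
    Matrix.mul_one, transpose_mul_proj_add]

theorem dotProduct_storage_mulVec (P : Matrix (Fin d.v) (Fin d.v) ℝ) (e w : Fin n → ℝ) :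
    e ⬝ᵥ d.storage P *ᵥ w = (d.proj₁ *ᵥ e) ⬝ᵥ P *ᵥ (d.proj₁ *ᵥ w)
      + (d.proj₂ *ᵥ e) ⬝ᵥ (d.proj₂ *ᵥ w) := by
  rw [storage, add_mulVec, dotProduct_add, Matrix.mul_assoc, ← mulVec_mulVec, ← mulVec_mulVec,
    ← mulVec_mulVec, ← dotProduct_mulVec_transpose_comm, ← dotProduct_mulVec_transpose_comm]

theorem transpose_storage {P : Matrix (Fin d.v) (Fin d.v) ℝ} (hP : Pᵀ = P) :
    (d.storage P)ᵀ = d.storage P := by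
  simp [storage, transpose_mul, hP, Matrix.mul_assoc]

theorem dotProduct_self_eq (e : Fin n → ℝ) :
    e ⬝ᵥ e = (d.proj₁ *ᵥ e) ⬝ᵥ (d.proj₁ *ᵥ e) + (d.proj₂ *ᵥ e) ⬝ᵥ (d.proj₂ *ᵥ e) := by
  have := dotProduct_storage_mulVec d 1 e e
  rwa [storage, Matrix.mul_one, transpose_mul_proj_add, one_mulVec, one_mulVec] at this

theorem storage_pos {P : Matrix (Fin d.v) (Fin d.v) ℝ} (hP : P.PosDef) {e : Fin n → ℝ}
    (he : e ≠ 0) : 0 < e ⬝ᵥ d.storage P *ᵥ e := by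
  rw [dotProduct_storage_mulVec]
  have h2 := dotProduct_self_nonneg_real (d.proj₂ *ᵥ e)
  by_cases h1 : d.proj₁ *ᵥ e = 0
  · have h3 := dotProduct_self_eq d e
    have h4 : 0 < e ⬝ᵥ e := (dotProduct_self_nonneg_real e).lt_of_ne fun h =>
      he (dotProduct_self_eq_zero.1 h.symm)
    rw [h1, dotProduct_zero] at h3
    rw [h1, mulVec_zero, dotProduct_zero]
    linarith
  · linarith [(posDef_real_iff.1 hP).2 _ h1]

/-- The gain G acts only on the first coordinates, so E - GD has the coordinate blocks E₁ - G₁D and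
E₂. -/
theorem traceTerm_eq (E : Matrix (Fin n) (Fin q) ℝ) (D : Matrix (Fin s) (Fin q) ℝ)
    (Q P : Matrix (Fin d.v) (Fin d.v) ℝ) :
    d.traceTerm E D Q P
      = ∑ k, (E - d.gainG Q * D).col k ⬝ᵥ d.storage P *ᵥ (E - d.gainG Q * D).col k := by
  have h1 : d.proj₁ * (E - d.gainG Q * D) = d.E₁ E - d.G₁ Q * D := by
    rw [Matrix.mul_sub, gainG_eq, ← Matrix.mul_assoc, ← Matrix.mul_assoc, proj₁_mul_transpose,
      Matrix.one_mul]
    rfl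
  have h2 : d.proj₂ * (E - d.gainG Q * D) = d.E₂ E := by
    rw [Matrix.mul_sub, gainG_eq, ← Matrix.mul_assoc, ← Matrix.mul_assoc,
      proj₂_mul_proj₁_transpose, Matrix.zero_mul, Matrix.zero_mul, sub_zero]
    rfl
  have h3 : (d.E₁ E - d.G₁ Q * D)ᵀ * P * (d.E₁ E - d.G₁ Q * D) + (d.E₂ E)ᵀ * d.E₂ E
      = (E - d.gainG Q * D)ᵀ * (d.storage P * (E - d.gainG Q * D)) := by
    rw [← h1, ← h2, storage]
    simp only [transpose_mul, Matrix.mul_add, Matrix.add_mul, Matrix.mul_assoc]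
  rw [traceTerm, h3]
  rfl

theorem exists_riccatiIneq : ∃ Q : Matrix (Fin d.v) (Fin d.v) ℝ, Q.PosDef ∧ d.RiccatiIneq Q :=
  exists_riccati_of_isDetectable d.detectable

theorem exists_forall_kappaIneq (H : Matrix (Fin p) (Fin n) ℝ) {ε : ℝ} (hε : 0 < ε) :
    ∃ κ₀ : ℝ, 0 < κ₀ ∧ ∀ κ : ℝ, κ₀ ≤ κ → d.KappaIneq H ε κ :=
  exists_forall_posDef_neg_sub_smul
    (by rw [transpose_add, transpose_add, transpose_mul, transpose_transpose, transpose_transpose,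
      add_comm d.A₂₂ᵀ])
    (by rw [transpose_mul, transpose_transpose]) hε

variable {d} {Q P : Matrix (Fin d.v) (Fin d.v) ℝ} {H : Matrix (Fin p) (Fin n) ℝ} {ε κ : ℝ}

/-- With K = A₁₁ - G₁C₁, the matrix KQ + QKᵀ is the Riccati expression minus QC₁ᵀC₁Q, hence negative
definite. So Q⁻¹ gives a Lyapunov function for K. -/
theorem tendsto_exp_of_riccatiIneq (hQ : Q.PosDef) (hQR : d.RiccatiIneq Q) (v : Fin d.v → ℝ) :
    Filter.Tendsto (fun t : ℝ => NormedSpace.exp (t • (d.A₁₁ - d.G₁ Q * d.C₁)) *ᵥ v)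
      Filter.atTop (nhds 0) := by
  have hQs := (posDef_real_iff.1 hQ).1
  refine tendsto_exp_smul_mulVec_of_lyapunov (posDef_real_iff.1 hQ.inv).2
    (fun x hx => lyapunov_inv_neg hQ (fun y hy => ?_) hx) v
  have h1 := (posDef_real_iff.1 hQR).2 y hy
  have h2 : (d.A₁₁ - d.G₁ Q * d.C₁) * Q + Q * (d.A₁₁ - d.G₁ Q * d.C₁)ᵀ
      = (d.A₁₁ * Q + Q * d.A₁₁ᵀ - Q * d.C₁ᵀ * d.C₁ * Q) - (d.C₁ * Q)ᵀ * (d.C₁ * Q) := by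
    simp only [G₁, transpose_sub, transpose_mul, transpose_transpose, hQs, Matrix.sub_mul,
      Matrix.mul_sub, Matrix.mul_assoc]
    abel
  have h3 := dotProduct_self_nonneg_real ((d.C₁ * Q) *ᵥ y)
  rw [neg_mulVec, dotProduct_neg] at h1
  rw [h2, sub_mulVec, dotProduct_sub, dotProduct_transpose_mul_self_mulVec]
  linarith

theorem existsUnique_lyapunovEq (hQ : Q.PosDef) (hQR : d.RiccatiIneq Q) (hκ : 0 < κ) :
    ∃! P : Matrix (Fin d.v) (Fin d.v) ℝ, P.PosDef ∧ d.LyapunovEq H Q κ P := by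
  have hR : ((d.H₁ H)ᵀ * d.H₁ H + κ • (1 : Matrix (Fin d.v) (Fin d.v) ℝ)).PosDef := by
    refine PosDef.posSemidef_add ?_ (PosDef.one.smul hκ)
    simpa using posSemidef_conjTranspose_mul_self (d.H₁ H)
  simpa only [LyapunovEq, add_assoc] using
    existsUnique_lyapunov (tendsto_exp_of_riccatiIneq hQ hQR) hR

/-- The dissipation inequality of one local filter. -/
theorem local_dissipation (hP : P.PosDef) (hL : d.LyapunovEq H Q κ P) (hε : 0 < ε) (hκ : 0 < κ)
    (hk : d.KappaIneq H ε κ) (e : Fin n → ℝ) :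
    2 * (e ⬝ᵥ d.storage P *ᵥ ((A - d.gainG Q * C) *ᵥ e)) + (H *ᵥ e) ⬝ᵥ (H *ᵥ e)
      + κ * ((d.proj₁ *ᵥ e) ⬝ᵥ (d.proj₁ *ᵥ e)) ≤ κ * ε * (e ⬝ᵥ e) := by
  set x := d.proj₁ *ᵥ e with hx
  set y := d.proj₂ *ᵥ e with hy
  have hPs := (posDef_real_iff.1 hP).1
  set K := d.A₁₁ - d.G₁ Q * d.C₁ with hK
  have e1 : d.proj₁ *ᵥ ((A - d.gainG Q * C) *ᵥ e) = K *ᵥ x := by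
    rw [mulVec_mulVec, hx, mulVec_mulVec, Matrix.mul_sub, proj₁_mul_A, gainG_eq,
      ← Matrix.mul_assoc, ← Matrix.mul_assoc, proj₁_mul_transpose, Matrix.one_mul, hK,
      Matrix.sub_mul, Matrix.mul_assoc (d.G₁ Q), ← C_eq]
  have e2 : d.proj₂ *ᵥ ((A - d.gainG Q * C) *ᵥ e) = d.A₂₁ *ᵥ x + d.A₂₂ *ᵥ y := by
    rw [mulVec_mulVec, hx, hy, mulVec_mulVec, mulVec_mulVec, ← add_mulVec, Matrix.mul_sub,
      proj₂_mul_A, gainG_eq, ← Matrix.mul_assoc, ← Matrix.mul_assoc, proj₂_mul_proj₁_transpose,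
      Matrix.zero_mul, Matrix.zero_mul, sub_zero]
  have e3 : H *ᵥ e = d.H₁ H *ᵥ x + d.H₂ H *ᵥ y := by
    rw [hx, hy, mulVec_mulVec, mulVec_mulVec, ← add_mulVec, ← H_eq]
  have e4 : 2 * (x ⬝ᵥ P *ᵥ (K *ᵥ x)) + (d.H₁ H *ᵥ x) ⬝ᵥ (d.H₁ H *ᵥ x) + κ * (x ⬝ᵥ x) = 0 := by
    have h1 := congrArg (fun M => x ⬝ᵥ M *ᵥ x) hL
    simp only [add_mulVec, dotProduct_add, smul_mulVec, one_mulVec, dotProduct_smul, smul_eq_mul,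
      zero_mulVec, dotProduct_zero, dotProduct_transpose_mul_self_mulVec] at h1
    rw [← hK, ← mulVec_mulVec, ← mulVec_mulVec, dotProduct_transpose_mulVec,
      dotProduct_mulVec_transpose_comm, hPs] at h1
    linarith
  set B := d.A₂₁ + (d.H₂ H)ᵀ * d.H₁ H with hB
  have e5 : y ⬝ᵥ B *ᵥ x = y ⬝ᵥ d.A₂₁ *ᵥ x + (d.H₂ H *ᵥ y) ⬝ᵥ (d.H₁ H *ᵥ x) := by
    rw [hB, add_mulVec, dotProduct_add, ← mulVec_mulVec, ← dotProduct_mulVec_transpose_comm]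
  have e6 : 2 * (y ⬝ᵥ d.A₂₂ *ᵥ y) + (d.H₂ H *ᵥ y) ⬝ᵥ (d.H₂ H *ᵥ y)
      + 1 / (κ * ε) * ((Bᵀ *ᵥ y) ⬝ᵥ (Bᵀ *ᵥ y)) ≤ κ * ε * (y ⬝ᵥ y) :=
    dotProduct_le_of_posDef_neg hk y
  -- The weight κε makes the term in Bᵀy the one absorbed by the κ-inequality `e6`; the two
  -- remainders add up to κε(|x|² + |y|²) = κε|e|².
  have e7 : 2 * (y ⬝ᵥ B *ᵥ x) ≤ κ * ε * (x ⬝ᵥ x) + 1 / (κ * ε) * ((Bᵀ *ᵥ y) ⬝ᵥ (Bᵀ *ᵥ y)) :=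
    two_mul_dotProduct_mulVec_le B x y (mul_pos hκ hε)
  rw [dotProduct_storage_mulVec, e1, e2, e3, dotProduct_self_eq d e, ← hx, ← hy]
  simp only [dotProduct_add, add_dotProduct, dotProduct_comm (d.H₁ H *ᵥ x) (d.H₂ H *ᵥ y)]
  linarith

end DetectabilityDecomposition

/-! ### Node coordinates and the ε-inequality on the network. -/

namespace Matrix

theorem blockDiagonal'_mulVec_apply {o : Type*} {m n : o → Type*} [Fintype o] [DecidableEq o]
    [∀ i, Fintype (n i)] (M : ∀ i, Matrix (m i) (n i) ℝ) (f : (Σ i, n i) → ℝ) (i : o) (c : m i) :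
    (blockDiagonal' M *ᵥ f) ⟨i, c⟩ = (M i *ᵥ fun c' => f ⟨i, c'⟩) c := by
  rw [mulVec, dotProduct, Fintype.sum_sigma, Finset.sum_eq_single i]
  · simp [mulVec, dotProduct, blockDiagonal'_apply_eq]
  · intro j _ hj
    refine Finset.sum_eq_zero fun c' _ => ?_
    rw [blockDiagonal'_apply_ne _ _ _ hj.symm, zero_mul]
  · simp

end Matrix

namespace Plant

variable {N n q p : ℕ} {r : Fin N → ℕ}

/-- The component of a global vector at the node `i`. -/
def node {m : ℕ} (e : Fin N × Fin m → ℝ) (i : Fin N) : Fin m → ℝ := fun k => e (i, k)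

theorem dotProduct_eq_sum_node {m : ℕ} (e e' : Fin N × Fin m → ℝ) :
    e ⬝ᵥ e' = ∑ i, node e i ⬝ᵥ node e' i := by
  rw [dotProduct, Fintype.sum_prod_type]
  rfl

theorem node_blockDiag_mulVec (B : Fin N → Matrix (Fin n) (Fin n) ℝ) (e : Fin N × Fin n → ℝ)
    (i : Fin N) : node (blockDiag B *ᵥ e) i = B i *ᵥ node e i := by
  funext k
  simp [node, mulVec, dotProduct, blockDiag, Fintype.sum_prod_type, ite_mul]

theorem node_kronecker_one_mulVec (B : Matrix (Fin N) (Fin N) ℝ) (e : Fin N × Fin n → ℝ)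
    (i : Fin N) :
    node ((B ⊗ₖ (1 : Matrix (Fin n) (Fin n) ℝ)) *ᵥ e) i = ∑ j, B i j • node e j := by
  funext k
  simp [node, mulVec, dotProduct, Fintype.sum_prod_type, one_apply, Finset.sum_apply]

theorem node_one_kronecker_mulVec (H : Matrix (Fin p) (Fin n) ℝ) (e : Fin N × Fin n → ℝ)
    (i : Fin N) :
    node (((1 : Matrix (Fin N) (Fin N) ℝ) ⊗ₖ H) *ᵥ e) i = H *ᵥ node e i := by
  funext k
  simp [node, mulVec, dotProduct, Fintype.sum_prod_type, one_apply]

theorem dotProduct_kronecker_one_mulVec (B : Matrix (Fin N) (Fin N) ℝ) (e : Fin N × Fin n → ℝ) :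
    e ⬝ᵥ (B ⊗ₖ (1 : Matrix (Fin n) (Fin n) ℝ)) *ᵥ e
      = ∑ k, (fun i => e (i, k)) ⬝ᵥ B *ᵥ (fun i => e (i, k)) := by
  rw [dotProduct_eq_sum_node]
  simp only [node_kronecker_one_mulVec]
  simp only [dotProduct, node, mulVec, Finset.sum_apply, Pi.smul_apply, smul_eq_mul]
  exact Finset.sum_comm

theorem node_errorMatrix_mulVec (S : Plant N n q p r) (g : WeightedDigraph N)
    (F : Fin N → Matrix (Fin n) (Fin n) ℝ) (G : ∀ i, Matrix (Fin n) (Fin (r i)) ℝ)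
    (e : Fin N × Fin n → ℝ) (i : Fin N) :
    node (S.errorMatrix g F G *ᵥ e) i
      = (S.A - G i * S.C i) *ᵥ node e i - F i *ᵥ ∑ j, g.laplacian i j • node e j := by
  have h : ∀ a b : Fin N × Fin n → ℝ, node (a - b) i = node a i - node b i := fun _ _ => rfl
  rw [errorMatrix, sub_mulVec, h, node_blockDiag_mulVec, ← mulVec_mulVec, node_blockDiag_mulVec,
    node_kronecker_one_mulVec]

section Decomposition

variable (S : Plant N n q p r) (dec : ∀ i, DetectabilityDecomposition (S.C i) S.A)

/-- Written as a reindexing along equivalences, `blockT` inherits orthogonality from its diagonal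
blocks. -/
theorem blockT_eq : S.blockT dec = (Matrix.blockDiagonal' fun i => (dec i).T).submatrix
    (Equiv.sigmaEquivProd (Fin N) (Fin n)).symm (Equiv.refl _) := rfl

theorem blockT_mul_transpose : S.blockT dec * (S.blockT dec)ᵀ = 1 := by
  rw [blockT_eq, transpose_submatrix, submatrix_mul_equiv, blockDiagonal'_transpose,
    ← blockDiagonal'_mul]
  simp only [(dec _).mul_transpose_self]
  rw [show (blockDiagonal' fun _ : Fin N => (1 : Matrix (Fin n) (Fin n) ℝ)) = 1
    from blockDiagonal'_one, submatrix_one_equiv]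

theorem transpose_blockT_mul : (S.blockT dec)ᵀ * S.blockT dec = 1 := by
  rw [blockT_eq, transpose_submatrix, submatrix_mul_equiv, blockDiagonal'_transpose,
    ← blockDiagonal'_mul]
  simp only [(dec _).transpose_mul_self]
  rw [show (blockDiagonal' fun i : Fin N => (1 : Matrix (Fin (dec i).v ⊕ Fin (n - (dec i).v))
    (Fin (dec i).v ⊕ Fin (n - (dec i).v)) ℝ)) = 1 from blockDiagonal'_one, submatrix_one_equiv]

theorem transpose_blockT_mulVec_apply (e : Fin N × Fin n → ℝ) (i : Fin N)
    (c : Fin (dec i).v ⊕ Fin (n - (dec i).v)) :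
    ((S.blockT dec)ᵀ *ᵥ e) ⟨i, c⟩ = ((dec i).Tᵀ *ᵥ node e i) c := by
  have h : ((S.blockT dec)ᵀ *ᵥ e) = (Matrix.blockDiagonal' fun i => (dec i).Tᵀ) *ᵥ
      (e ∘ Equiv.sigmaEquivProd (Fin N) (Fin n)) := by
    rw [blockT_eq, transpose_submatrix, blockDiagonal'_transpose, submatrix_mulVec_equiv]
    rfl
  rw [h, blockDiagonal'_mulVec_apply]
  rfl

theorem dotProduct_blockM_mulVec (e : Fin N × Fin n → ℝ) :
    ((S.blockT dec)ᵀ *ᵥ e) ⬝ᵥ S.blockM dec *ᵥ ((S.blockT dec)ᵀ *ᵥ e)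
      = ∑ i, ((dec i).proj₁ *ᵥ node e i) ⬝ᵥ ((dec i).proj₁ *ᵥ node e i) := by
  rw [dotProduct, Fintype.sum_sigma]
  refine Finset.sum_congr rfl fun i _ => ?_
  have h : ∀ c, (S.blockM dec *ᵥ ((S.blockT dec)ᵀ *ᵥ e)) ⟨i, c⟩
      = Sum.elim ((dec i).proj₁ *ᵥ node e i) 0 c := by
    intro c
    rw [blockM, blockDiagonal'_mulVec_apply]
    simp only [transpose_blockT_mulVec_apply]
    rw [fromBlocks_mulVec]
    simp
    rfl
  simp only [h, transpose_blockT_mulVec_apply, Fintype.sum_sum_type, Sum.elim_inl, Sum.elim_inr,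
    Pi.zero_apply, mul_zero, Finset.sum_const_zero, add_zero]
  rfl

/-- The quadratic form of the `ε`-inequality in the original coordinates. -/
theorem dotProduct_epsilon_mulVec (L : Matrix (Fin N) (Fin N) ℝ) (ε : ℝ)
    (e : Fin N × Fin n → ℝ) :
    ((S.blockT dec)ᵀ *ᵥ e) ⬝ᵥ ((S.blockT dec)ᵀ * (L ⊗ₖ (1 : Matrix (Fin n) (Fin n) ℝ))
        * S.blockT dec + S.blockM dec - ε • 1) *ᵥ ((S.blockT dec)ᵀ *ᵥ e)
      = e ⬝ᵥ (L ⊗ₖ (1 : Matrix (Fin n) (Fin n) ℝ)) *ᵥ e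
        + ∑ i, ((dec i).proj₁ *ᵥ node e i) ⬝ᵥ ((dec i).proj₁ *ᵥ node e i) - ε * (e ⬝ᵥ e) := by
  have hT : S.blockT dec *ᵥ ((S.blockT dec)ᵀ *ᵥ e) = e := by
    rw [mulVec_mulVec, blockT_mul_transpose, one_mulVec]
  rw [sub_mulVec, add_mulVec, dotProduct_sub, dotProduct_add, dotProduct_blockM_mulVec,
    smul_mulVec, one_mulVec, dotProduct_smul, smul_eq_mul, ← mulVec_mulVec, ← mulVec_mulVec, hT,
    ← dotProduct_mulVec_transpose_comm (S.blockT dec), hT]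
  congr 2
  rw [dotProduct_mulVec_transpose_comm, transpose_transpose, hT]

variable {S dec} {g : WeightedDigraph N} {θ : Fin N → ℝ}

theorem lt_of_epsilonIneq {ε : ℝ} (h : S.EpsilonIneq g θ dec ε) {e : Fin N × Fin n → ℝ}
    (he : e ≠ 0) :
    ε * (e ⬝ᵥ e) < e ⬝ᵥ (g.symLaplacian θ ⊗ₖ (1 : Matrix (Fin n) (Fin n) ℝ)) *ᵥ e
      + ∑ i, ((dec i).proj₁ *ᵥ node e i) ⬝ᵥ ((dec i).proj₁ *ᵥ node e i) := by
  have h1 := (posDef_real_iff.1 h).2 ((S.blockT dec)ᵀ *ᵥ e) fun h0 => he (by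
    have := congrArg (fun v => S.blockT dec *ᵥ v) h0
    simpa [mulVec_mulVec, blockT_mul_transpose] using this)
  rw [dotProduct_epsilon_mulVec] at h1
  linarith

/-- At a zero of the form, the Laplacian part forces equal node components and the projections put
the component at i into the undetectable subspace of (Cᵢ, A). The common vector is then undetectable
for the stacked output. -/
theorem pos_of_isDetectable (hg : g.StronglyConnected)
    (hS : IsDetectable S.stackedC S.A) (hθ : g.IsLeftNullVector θ) {e : Fin N × Fin n → ℝ}
    (he : e ≠ 0) :
    0 < e ⬝ᵥ (g.symLaplacian θ ⊗ₖ (1 : Matrix (Fin n) (Fin n) ℝ)) *ᵥ e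
      + ∑ i, ((dec i).proj₁ *ᵥ node e i) ⬝ᵥ ((dec i).proj₁ *ᵥ node e i) := by
  have hk : ∀ k ∈ Finset.univ, 0 ≤ (fun i => e (i, k)) ⬝ᵥ g.symLaplacian θ *ᵥ fun i => e (i, k) :=
    fun k _ => WeightedDigraph.dotProduct_symLaplacian_mulVec_nonneg hθ _
  have hi : ∀ i ∈ Finset.univ,
      0 ≤ ((dec i).proj₁ *ᵥ node e i) ⬝ᵥ ((dec i).proj₁ *ᵥ node e i) :=
    fun i _ => dotProduct_self_nonneg_real _
  rw [dotProduct_kronecker_one_mulVec]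
  refine (add_nonneg (Finset.sum_nonneg hk) (Finset.sum_nonneg hi)).lt_of_ne fun h0 => he ?_
  obtain ⟨h1, h2⟩ := (add_eq_zero_iff_of_nonneg (Finset.sum_nonneg hk)
    (Finset.sum_nonneg hi)).1 h0.symm
  rw [Finset.sum_eq_zero_iff_of_nonneg hk] at h1
  rw [Finset.sum_eq_zero_iff_of_nonneg hi] at h2
  have hconst : ∀ i j, node e i = node e j := fun i j => funext fun k =>
    WeightedDigraph.apply_eq_of_dotProduct_symLaplacian_mulVec_eq_zero hg hθ
      (h1 k (Finset.mem_univ k)) i j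
  have hmem : ∀ i, node e i ∈ undetectableSubspace (S.C i) S.A := fun i =>
    ((dec i).toRows₁_mulVec_eq_zero_iff _).1
      (dotProduct_self_eq_zero.1 (h2 i (Finset.mem_univ i)))
  have hzero : ∀ i, node e i = 0 := fun i => by
    refine isDetectable_iff.1 hS _ (fun k => ?_) (mem_undetectableSubspace_iff.1 (hmem i)).2
    funext a
    have h3 := (mem_undetectableSubspace_iff.1 (hmem a.1)).1 k
    rw [hconst a.1 i] at h3
    exact congrFun h3 a.2
  funext a
  exact congrFun (hzero a.1) a.2

theorem exists_forall_epsilonIneq (hg : g.StronglyConnected)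
    (hS : IsDetectable S.stackedC S.A) (hθ : g.IsLeftNullVector θ) :
    ∃ ε₀ : ℝ, 0 < ε₀ ∧ ∀ ε : ℝ, 0 < ε → ε ≤ ε₀ → S.EpsilonIneq g θ dec ε := by
  obtain ⟨c, hc, hce⟩ := exists_coercive (M := (S.blockT dec)ᵀ *
    (g.symLaplacian θ ⊗ₖ (1 : Matrix (Fin n) (Fin n) ℝ)) * S.blockT dec + S.blockM dec) (by
      intro f hf
      have hf' : f = (S.blockT dec)ᵀ *ᵥ (S.blockT dec *ᵥ f) := by
        rw [mulVec_mulVec, transpose_blockT_mul, one_mulVec]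
      have h1 := dotProduct_epsilon_mulVec S dec (g.symLaplacian θ) 0 (S.blockT dec *ᵥ f)
      rw [zero_smul, sub_zero, zero_mul, sub_zero, ← hf'] at h1
      rw [h1]
      refine pos_of_isDetectable hg hS hθ fun h0 => hf ?_
      rw [hf', h0, mulVec_zero])
  -- Half the coercivity constant leaves room for the strict inequality.
  refine ⟨c / 2, by positivity, fun ε hε hle => posDef_real_iff.2 ⟨?_, fun f hf => ?_⟩⟩
  · have hL : (g.symLaplacian θ)ᵀ = g.symLaplacian θ := by
      rw [WeightedDigraph.symLaplacian, transpose_add, transpose_mul, transpose_mul,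
        transpose_transpose, diagonal_transpose, add_comm]
    have hM : (S.blockM dec)ᵀ = S.blockM dec := by
      rw [blockM, blockDiagonal'_transpose]
      simp only [fromBlocks_transpose, transpose_one, transpose_zero]
    rw [transpose_sub, transpose_add, hM, transpose_smul, transpose_one, transpose_mul,
      transpose_mul, transpose_transpose, ← kroneckerMap_transpose, hL, transpose_one,
      Matrix.mul_assoc]
  · have h1 := hce f
    have h2 : 0 < f ⬝ᵥ f := (dotProduct_self_nonneg_real f).lt_of_ne fun h =>
      hf (dotProduct_self_eq_zero.1 h.symm)
    rw [sub_mulVec, dotProduct_sub, smul_mulVec, one_mulVec, dotProduct_smul, smul_eq_mul]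
    nlinarith

end Decomposition

end Plant

/-! ### The global error system: dissipation, stability and the H₂ cost. -/

namespace Plant

variable {N n q p : ℕ} {r : Fin N → ℕ} {S : Plant N n q p r} {g : WeightedDigraph N}

theorem node_error_hasDerivWithinAt {F : Fin N → Matrix (Fin n) (Fin n) ℝ}
    {G : ∀ i, Matrix (Fin n) (Fin (r i)) ℝ} {x : ℝ → Fin n → ℝ} {w : Fin N → ℝ → Fin n → ℝ}
    (h : S.IsTrajectory g F G (fun _ => 0) x w) {t : ℝ} (ht : 0 ≤ t) :
    HasDerivWithinAt (fun t (a : Fin N × Fin n) => x t a.2 - w a.1 t a.2)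
      (S.errorMatrix g F G *ᵥ fun a => x t a.2 - w a.1 t a.2) (Set.Ici 0) t := by
  obtain ⟨hx, hw⟩ := h t ht
  rw [hasDerivWithinAt_pi]
  rintro ⟨i, k⟩
  have h1 := (hasDerivWithinAt_pi.1 (hx.sub (hw i))) k
  refine HasDerivWithinAt.congr_deriv h1 (Eq.symm ?_)
  change node (S.errorMatrix g F G *ᵥ _) i k = _
  rw [node_errorMatrix_mulVec]
  refine congrFun ?_ k
  have h2 : ∀ j, node (fun a : Fin N × Fin n => x t a.2 - w a.1 t a.2) j = x t - w j t :=
    fun j => rfl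
  -- The rows of L sum to zero, so x drops out of the coupling.
  have h3 : ∑ j, g.laplacian i j • (x t - w j t) = ∑ j, g.weight i j • (w j t - w i t) := by
    have hl : ∀ j, g.laplacian i j • (x t - w j t)
        = (if i = j then (∑ k, g.weight i k) • (x t - w i t) else 0)
          - g.weight i j • (x t - w j t) := fun j => by
      rw [WeightedDigraph.laplacian, Matrix.sub_apply, diagonal_apply, sub_smul]
      split_ifs with hij
      · rw [hij]
      · rw [zero_smul]
    simp only [hl, Finset.sum_sub_distrib, Finset.sum_ite_eq, Finset.mem_univ, if_true,
      Finset.sum_smul]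
    rw [← Finset.sum_sub_distrib]
    refine Finset.sum_congr rfl fun j _ => ?_
    rw [← smul_sub]
    congr 1
    abel
  simp only [h2, h3, mulVec_zero, add_zero, sub_mulVec, mulVec_sub, mulVec_mulVec]
  abel

variable {dec : ∀ i, DetectabilityDecomposition (S.C i) S.A} {θ : Fin N → ℝ} {ε κ : ℝ}
  {Q P : ∀ i, Matrix (Fin (dec i).v) (Fin (dec i).v) ℝ}

/-- The dissipation inequality of the global error system. -/
theorem global_dissipation (hε : 0 < ε) (hE : S.EpsilonIneq g θ dec ε) (hκ : 0 < κ)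
    (hk : ∀ i, (dec i).KappaIneq S.H ε κ)
    (hP : ∀ i, (P i).PosDef ∧ (dec i).LyapunovEq S.H (Q i) κ (P i)) {e : Fin N × Fin n → ℝ}
    (he : e ≠ 0) :
    e ⬝ᵥ ((S.errorMatrix g (fun i => (dec i).gainF (κ * θ i) (P i))
          (fun i => (dec i).gainG (Q i)))ᵀ * blockDiag (fun i => (dec i).storage (P i))
        + blockDiag (fun i => (dec i).storage (P i))
          * S.errorMatrix g (fun i => (dec i).gainF (κ * θ i) (P i))
            (fun i => (dec i).gainG (Q i))) *ᵥ e
      + (((1 : Matrix (Fin N) (Fin N) ℝ) ⊗ₖ S.H) *ᵥ e)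
        ⬝ᵥ (((1 : Matrix (Fin N) (Fin N) ℝ) ⊗ₖ S.H) *ᵥ e) < 0 := by
  set K := S.errorMatrix g (fun i => (dec i).gainF (κ * θ i) (P i))
    (fun i => (dec i).gainG (Q i)) with hK
  set X := blockDiag (fun i => (dec i).storage (P i)) with hX
  have hXs : ∀ a b, a ⬝ᵥ X *ᵥ b = ∑ i, node a i ⬝ᵥ (dec i).storage (P i) *ᵥ node b i :=
    fun a b => by simp only [dotProduct_eq_sum_node, hX, node_blockDiag_mulVec]
  have h1 : ∀ i, node e i ⬝ᵥ (dec i).storage (P i) *ᵥ node (K *ᵥ e) i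
      = node e i ⬝ᵥ (dec i).storage (P i) *ᵥ ((S.A - (dec i).gainG (Q i) * S.C i) *ᵥ node e i)
        - κ * (θ i * (node e i ⬝ᵥ ∑ j, g.laplacian i j • node e j)) := fun i => by
    rw [hK, node_errorMatrix_mulVec, mulVec_sub, dotProduct_sub, mulVec_mulVec _ _
      ((dec i).gainF (κ * θ i) (P i)), (dec i).storage_mul_gainF _ (hP i).1, smul_mulVec,
      one_mulVec, dotProduct_smul, smul_eq_mul, mul_assoc]
  have h2 : (K *ᵥ e) ⬝ᵥ X *ᵥ e = e ⬝ᵥ X *ᵥ (K *ᵥ e) := by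
    rw [hXs, hXs]
    refine Finset.sum_congr rfl fun i _ => ?_
    rw [← dotProduct_transpose_mulVec, (dec i).transpose_storage (posDef_real_iff.1 (hP i).1).1]
  have h3 : e ⬝ᵥ (g.symLaplacian θ ⊗ₖ (1 : Matrix (Fin n) (Fin n) ℝ)) *ᵥ e
      = 2 * ∑ i, θ i * (node e i ⬝ᵥ ∑ j, g.laplacian i j • node e j) := by
    have h4 : e ⬝ᵥ ((diagonal θ * g.laplacian) ⊗ₖ (1 : Matrix (Fin n) (Fin n) ℝ)) *ᵥ e
        = ∑ i, θ i * (node e i ⬝ᵥ ∑ j, g.laplacian i j • node e j) := by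
      rw [dotProduct_eq_sum_node]
      refine Finset.sum_congr rfl fun i _ => ?_
      rw [node_kronecker_one_mulVec]
      simp only [diagonal_mul, mul_smul, ← Finset.smul_sum]
      rw [dotProduct_smul, smul_eq_mul]
    have h5 : g.symLaplacian θ ⊗ₖ (1 : Matrix (Fin n) (Fin n) ℝ)
        = (diagonal θ * g.laplacian) ⊗ₖ (1 : Matrix (Fin n) (Fin n) ℝ)
          + ((diagonal θ * g.laplacian) ⊗ₖ (1 : Matrix (Fin n) (Fin n) ℝ))ᵀ := by
      rw [← kroneckerMap_transpose, transpose_one, transpose_mul, diagonal_transpose,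
        ← add_kronecker]
      rfl
    rw [h5, add_mulVec, dotProduct_add, dotProduct_transpose_mulVec, h4, two_mul]
  have h6 : e ⬝ᵥ X *ᵥ (K *ᵥ e)
      = ∑ i, node e i ⬝ᵥ (dec i).storage (P i) *ᵥ
          ((S.A - (dec i).gainG (Q i) * S.C i) *ᵥ node e i)
        - κ * ∑ i, θ i * (node e i ⬝ᵥ ∑ j, g.laplacian i j • node e j) := by
    rw [hXs, Finset.mul_sum, ← Finset.sum_sub_distrib]
    exact Finset.sum_congr rfl fun i _ => h1 i
  have h7 := lt_of_epsilonIneq hE he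
  have h8 := Finset.sum_le_sum fun i (_ : i ∈ Finset.univ) =>
    (dec i).local_dissipation (hP i).1 (hP i).2 hε hκ (hk i) (node e i)
  simp only [Finset.sum_add_distrib, ← Finset.mul_sum] at h8
  rw [← lyapunov_dotProduct, h2, h6, dotProduct_eq_sum_node (((1 : Matrix _ _ ℝ) ⊗ₖ S.H) *ᵥ e)]
  simp only [node_one_kronecker_mulVec]
  rw [h3, dotProduct_eq_sum_node e e] at h7
  -- Multiplied by κ, the ε-inequality absorbs the κε|e|² left over by the local estimates, using
  -- the coupling term and the terms κ|xᵢ|².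
  have h9 := mul_lt_mul_of_pos_left h7 hκ
  linarith

theorem traceTerm_sum_eq : ∑ i, (dec i).traceTerm S.E (S.D i) (Q i) (P i)
    = ∑ k, (S.errorInput fun i => (dec i).gainG (Q i)).col k ⬝ᵥ
        blockDiag (fun i => (dec i).storage (P i)) *ᵥ
          (S.errorInput fun i => (dec i).gainG (Q i)).col k := by
  simp only [DetectabilityDecomposition.traceTerm_eq, dotProduct_eq_sum_node,
    node_blockDiag_mulVec]
  rw [Finset.sum_comm]
  rfl

/-- The trace splits over the columns of the input matrix: each contributes the output energy of the
solution started at that column, which its initial storage bounds. -/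
theorem h2Cost_le {F : Fin N → Matrix (Fin n) (Fin n) ℝ} {G : ∀ i, Matrix (Fin n) (Fin (r i)) ℝ}
    {X : Matrix (Fin N × Fin n) (Fin N × Fin n) ℝ} (hX : ∀ e, 0 ≤ e ⬝ᵥ X *ᵥ e)
    (hK : ∀ v, Filter.Tendsto (fun t : ℝ => NormedSpace.exp (t • S.errorMatrix g F G) *ᵥ v)
      Filter.atTop (nhds 0))
    (hdiss : ∀ e, e ⬝ᵥ ((S.errorMatrix g F G)ᵀ * X + X * S.errorMatrix g F G) *ᵥ e
      + (((1 : Matrix (Fin N) (Fin N) ℝ) ⊗ₖ S.H) *ᵥ e)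
        ⬝ᵥ (((1 : Matrix (Fin N) (Fin N) ℝ) ⊗ₖ S.H) *ᵥ e) ≤ 0) :
    S.h2Cost g F G
      ≤ ENNReal.ofReal (∑ k, (S.errorInput G).col k ⬝ᵥ X *ᵥ (S.errorInput G).col k) := by
  set K := S.errorMatrix g F G with hKdef
  set H : Matrix (Fin N × Fin p) (Fin N × Fin n) ℝ := (1 : Matrix (Fin N) (Fin N) ℝ) ⊗ₖ S.H
    with hH
  have htr : ∀ t : ℝ, trace ((S.impulseResponse g F G t)ᵀ * S.impulseResponse g F G t)
      = ∑ k, (H *ᵥ (NormedSpace.exp (t • K) *ᵥ (S.errorInput G).col k)) ⬝ᵥ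
        (H *ᵥ (NormedSpace.exp (t • K) *ᵥ (S.errorInput G).col k)) := fun t => by
    simp only [mulVec_mulVec]
    rfl
  have hmeas : ∀ k ∈ Finset.univ, Measurable fun t : ℝ => ENNReal.ofReal
      ((H *ᵥ (NormedSpace.exp (t • K) *ᵥ (S.errorInput G).col k)) ⬝ᵥ
        (H *ᵥ (NormedSpace.exp (t • K) *ᵥ (S.errorInput G).col k))) := fun k _ => by
    refine (Continuous.measurable ?_).ennreal_ofReal
    simp only [← dotProduct_transpose_mul_self_mulVec]
    exact continuous_iff_continuousAt.2 fun t =>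
      (hasDerivAt_dotProduct_exp K (Hᵀ * H) _ _ t).continuousAt
  rw [h2Cost]
  simp only [htr]
  simp only [ENNReal.ofReal_sum_of_nonneg fun k _ => dotProduct_self_nonneg_real
    (H *ᵥ (NormedSpace.exp (_ • K) *ᵥ (S.errorInput G).col k))]
  rw [MeasureTheory.lintegral_finsetSum _ hmeas,
    ENNReal.ofReal_sum_of_nonneg fun k _ => hX _]
  exact Finset.sum_le_sum fun k _ => lintegral_exp_output_le hK hdiss _

theorem isHurwitz_and_isH2Suboptimal (hε : 0 < ε) (hE : S.EpsilonIneq g θ dec ε) (hκ : 0 < κ)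
    (hk : ∀ i, (dec i).KappaIneq S.H ε κ)
    (hP : ∀ i, (P i).PosDef ∧ (dec i).LyapunovEq S.H (Q i) κ (P i)) {γ : ℝ} (hγ : 0 < γ)
    (hsum : ∑ i, (dec i).traceTerm S.E (S.D i) (Q i) (P i) < γ) :
    IsHurwitz (S.errorMatrix g (fun i => (dec i).gainF (κ * θ i) (P i))
      (fun i => (dec i).gainG (Q i))) ∧
    S.IsH2Suboptimal g (fun i => (dec i).gainF (κ * θ i) (P i))
      (fun i => (dec i).gainG (Q i)) γ := by
  have hdiss := fun e (he : e ≠ 0) => global_dissipation hε hE hκ hk hP he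
  set K := S.errorMatrix g (fun i => (dec i).gainF (κ * θ i) (P i))
    (fun i => (dec i).gainG (Q i)) with hK
  set X := blockDiag (fun i => (dec i).storage (P i)) with hX
  have hXs : ∀ a b, a ⬝ᵥ X *ᵥ b = ∑ i, node a i ⬝ᵥ (dec i).storage (P i) *ᵥ node b i :=
    fun a b => by simp only [dotProduct_eq_sum_node, hX, node_blockDiag_mulVec]
  have hXsymm : Xᵀ = X := by
    ext ⟨i, k⟩ ⟨j, l⟩
    have h := fun i => congrFun (congrFun ((dec i).transpose_storage
      (posDef_real_iff.1 (hP i).1).1) k) l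
    simp only [transpose_apply] at h
    by_cases hij : i = j
    · subst hij
      simp [hX, blockDiag, h]
    · simp [hX, blockDiag, hij, Ne.symm hij]
  have hnn : ∀ i (v : Fin n → ℝ), 0 ≤ v ⬝ᵥ (dec i).storage (P i) *ᵥ v := fun i v => by
    by_cases hv : v = 0
    · simp [hv]
    · exact ((dec i).storage_pos (hP i).1 hv).le
  have hXpos : ∀ e, e ≠ 0 → 0 < e ⬝ᵥ X *ᵥ e := fun e he => by
    obtain ⟨⟨i, k⟩, hik⟩ := Function.ne_iff.1 he
    rw [hXs]
    exact Finset.sum_pos' (fun i _ => hnn i _) ⟨i, Finset.mem_univ i,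
      (dec i).storage_pos (hP i).1 fun h0 => hik (congrFun h0 k)⟩
  have hneg : ∀ e, e ≠ 0 → e ⬝ᵥ (Kᵀ * X + X * K) *ᵥ e < 0 := fun e he => by
    have h1 := dotProduct_self_nonneg_real (((1 : Matrix (Fin N) (Fin N) ℝ) ⊗ₖ S.H) *ᵥ e)
    linarith [hdiss e he]
  refine ⟨isHurwitz_of_lyapunov hXsymm hXpos hneg, fun x w hxw i => ?_, ?_⟩
  · have h1 := tendsto_zero_of_lyapunov hXpos hneg fun t ht => node_error_hasDerivWithinAt hxw ht
    rw [tendsto_pi_nhds] at h1 ⊢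
    exact fun k => h1 (i, k)
  · refine lt_of_le_of_lt (h2Cost_le (X := X) (fun e => ?_)
      (tendsto_exp_smul_mulVec_of_lyapunov hXpos hneg) fun e => ?_) ?_
    · rw [hXs]
      exact Finset.sum_nonneg fun i _ => hnn i _
    · by_cases he : e = 0
      · simp [he]
      · exact (hdiss e he).le
    · rw [← traceTerm_sum_eq]
      exact (ENNReal.ofReal_lt_ofReal_iff hγ).2 hsum

end Plant

theorem theorem1 {N n q p : ℕ} (hN : 0 < N) {r : Fin N → ℕ}
    (g : WeightedDigraph N) (hg : g.StronglyConnected)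
    (S : Plant N n q p r) (hS : IsDetectable S.stackedC S.A) :
    (∃! θ : Fin N → ℝ, g.IsLeftNullVector θ) ∧
    (∀ i, Nonempty (DetectabilityDecomposition (S.C i) S.A)) ∧
    ∀ θ : Fin N → ℝ, g.IsLeftNullVector θ →
    ∀ dec : ∀ i, DetectabilityDecomposition (S.C i) S.A,
      (∃ ε₀ : ℝ, 0 < ε₀ ∧ ∀ ε : ℝ, 0 < ε → ε ≤ ε₀ → S.EpsilonIneq g θ dec ε) ∧
      (∀ i, ∃ Q : Matrix (Fin (dec i).v) (Fin (dec i).v) ℝ, Q.PosDef ∧ (dec i).RiccatiIneq Q) ∧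
      ∀ ε : ℝ, 0 < ε → S.EpsilonIneq g θ dec ε →
      ∀ Q : (∀ i, Matrix (Fin (dec i).v) (Fin (dec i).v) ℝ),
        (∀ i, (Q i).PosDef ∧ (dec i).RiccatiIneq (Q i)) →
        (∃ κ₀ : ℝ, 0 < κ₀ ∧ ∀ κ : ℝ, κ₀ ≤ κ → ∀ i, (dec i).KappaIneq S.H ε κ) ∧
        ∀ κ : ℝ, 0 < κ → (∀ i, (dec i).KappaIneq S.H ε κ) →
          (∀ i, ∃! P : Matrix (Fin (dec i).v) (Fin (dec i).v) ℝ,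
            P.PosDef ∧ (dec i).LyapunovEq S.H (Q i) κ P) ∧
          ∀ P : (∀ i, Matrix (Fin (dec i).v) (Fin (dec i).v) ℝ),
            (∀ i, (P i).PosDef ∧ (dec i).LyapunovEq S.H (Q i) κ (P i)) →
            ∀ γ : ℝ, 0 < γ →
              ∑ i, (dec i).traceTerm S.E (S.D i) (Q i) (P i) < γ →
              IsHurwitz (S.errorMatrix g (fun i => (dec i).gainF (κ * θ i) (P i))
                (fun i => (dec i).gainG (Q i))) ∧
              S.IsH2Suboptimal g (fun i => (dec i).gainF (κ * θ i) (P i))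
                (fun i => (dec i).gainG (Q i)) γ := by
  refine ⟨WeightedDigraph.existsUnique_isLeftNullVector hN hg,
    fun i => DetectabilityDecomposition.nonempty _ _, fun θ hθ dec =>
    ⟨Plant.exists_forall_epsilonIneq hg hS hθ, fun i => (dec i).exists_riccatiIneq,
    fun ε hε hE Q hQ => ⟨?_, fun κ hκ hk => ⟨fun i =>
      DetectabilityDecomposition.existsUnique_lyapunovEq (hQ i).1 (hQ i).2 hκ,
    fun P hP γ hγ hsum => Plant.isHurwitz_and_isH2Suboptimal hε hE hκ hk hP hγ hsum⟩⟩⟩⟩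
  choose κ₀ hκ₀ hκ using fun i => (dec i).exists_forall_kappaIneq S.H hε
  -- The sum serves as a common upper bound for the local thresholds.
  refine ⟨1 + ∑ i, κ₀ i, add_pos_of_pos_of_nonneg one_pos
    (Finset.sum_nonneg fun i _ => (hκ₀ i).le), fun κ h i => hκ i κ ?_⟩
  have := Finset.single_le_sum (fun i _ => (hκ₀ i).le) (Finset.mem_univ i)
  linarith
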